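/- **Setting.** Let $h>0$ and let $n,k\ge 1$ be integers. $C_n$ and $C^1_n$ are the Banach spaces of continuous, respectively continuously differentiable, maps $[-h,0]\to\mathbb{R}^n$ with norms $|\phi|_C=\max|\phi|$ and $|\phi|_C+|\phi'|_C$ (Euclidean norm on $\mathbb{R}^n$); $C=C_1$, $C^1=C^1_1$, and $X_0=\{\chi\in C^1_n:\chi'(0)=0\}$. Let $F$ be a finite-dimensional real normed space, $L:C_n\to F$ continuous and linear, $W\subset F$ and $V\subset\mathbb{R}^{kn}$ open, $g:V\to\mathbb{R}^n$ continuously differentiable, and $d=(d_1,\dots,d_k):W\to\mathbb{R}^k$ continuously differentiable with $d_\kappa(W)\subset[0,h]$ for every $\kappa$. Assume that some $\phi\in C^1_n$ satisfies $L\phi\in W$ and $(\phi_j(-d_\kappa(L\phi)))_{\kappa,j}\in V$, where the coordinate $\iota=(\kappa-1)n+j$ of $\mathbb{R}^{kn}$ is indexed by $(\kappa,j)$, $1\le\kappa\le k$, $1\le j\le n$. These are the data of the explicit-delay equation $$x'(t)=g\big(x(t-d_1(Lx_t)),\dots,x(t-d_k(Lx_t))\big),\qquad x_t(s)=x(t+s)\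 \text{ for } -h\le s\le 0 .$$ Let $I$ be an open interval and $J$ a compact interval with $[-h,0]\subset I\subset J\subset[-2h,h]$. For $\phi\in C$ let $E\phi:J\to\mathbb{R}$ be its odd extension: $E\phi(t)=\phi(t)$ on $[-h,0]$, $E\phi(t)=2\phi(-h)-\phi(-t-2h)$ for $t\le -h$, $E\phi(t)=2\phi(0)-\phi(-t)$ for $t\ge 0$. For $(r,\phi)\in J^k\times C_n$ let $\widehat{(r,\phi)}\in\mathbb{R}^{kn}$ be the vector with coordinates $E\phi_j(r_\kappa)$. Put $Q(r,\phi)=L\phi$ for $(r,\phi)\in J^k\times C_n$ and $\delta(r,w)=d(w)+r$ for $(r,w)\in J^k\times W$, and $$\mathcal U=\{(r,\phi)\in I^k\times C^1_n:\widehat{(r,\phi)}\in V,\ Q(r,\phi)\in W\},\qquad G(r,\phi)=g(\widehat{(r,\phi)}),\quad \Delta(r,\phi)=\delta(r,Q(r,\phi))\quad\text{on }\mathcal U .$$ The solution manifold of the system $x'(t)=G(r(t),x_t)$, $0=\Delta(r(t),x_t)$ is $$M_{G,\Delta}=\{(r,\phi)\in\mathcal U:\ \phi'(0)=G(r,\phi),\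 \Delta(r,\phi)=0,\ \det D_1\Delta(r,\phi)\ne0\}.$$ **The map $T$.** For $v\in V$ let $$h_g(v)=\frac{\min\{1,\operatorname{dist}(v,\mathbb{R}^{kn}\setminus V)\}}{6kn\,(1+\max_{\iota,j}|\partial_\iota g_j(v)|+\max_j|g_j(v)|)},$$ with numerator $1$ if $V=\mathbb{R}^{kn}$. Call $\chi=(\chi_1,\dots,\chi_n)$ *admissible* if the maps $\chi_j:I^k\times V\to C^1$ are continuously differentiable and, for all $j$, $\iota$ and all $(r,v)\in I^k\times V$, $$Q(r,\chi_j(r,v)\cdot e_j)=0,\qquad [\chi_j(r,v)]'(0)=1,\qquad |\chi_j(r,v)|_C\le h_g(v),\qquad |\partial_{v_\iota}\chi_j(r,v)|_C\le h_g(v),$$ where $\phi\cdot e_j\in C_n$ has $j$-th component $\phi$ and all other components $0$. For admissible $\chi$ define, for $(r,\phi)\in\mathcal U$, $$T(r,\phi)=\Big(r,\ \phi-\sum_{j=1}^n g_j(v)\,\chi_j(r,v)\cdot e_j\Big),\qquad v=\widehat{(r,\phi)} .$$ For $r\in I^k$ and $v\in V$ let $S_r(v)\in\mathbb{R}^{kn}$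 have the coordinates $v_\iota-g_j(v)\,E(\chi_j(r,v))(r_\kappa)$, where $\iota=(\kappa-1)n+j$, and let $$\mathcal O=\{(r,\psi)\in I^k\times C^1_n:\ Q(r,\psi)\in W,\ \widehat{(r,\psi)}\in S_r(V)\}.$$ **Corollary 5.1.** Admissible $\chi$ exist, and for every admissible $\chi$ the map $T$ is a $C^1$-diffeomorphism of the open set $\mathcal U$ onto the open set $\mathcal O\subset\mathbb{R}^k\times C^1_n$, and $$T(M_{G,\Delta})=\{(r,\psi)\in(I^k\times X_0)\cap\mathcal O:\ r=-d(L\psi)\}.$$ -/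

import Mathlib

open Set

noncomputable section

namespace AlgDelay

/-- `ℝᵐ` with the Euclidean norm; for `ℝᵏⁿ` the index `(κ, j)` stands for `(κ - 1) n + j`. -/
abbrev Eu (ι : Type) : Type := EuclideanSpace ℝ ι

/-- The initial interval `[-h, 0]`. -/
abbrev Iv (h : ℝ) : Type := Icc (-h) (0 : ℝ)

section spaces

variable {h : ℝ} [hh : Fact (0 < h)]

theorem neg_le_zero' : -h ≤ (0 : ℝ) := by
  have := hh.out
  linarith

/-- The right end point `0` of `[-h, 0]`. -/
def zeroPt : Iv h := ⟨0, neg_le_zero', le_refl _⟩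

/-- A function on `[-h, 0]` as a function on `ℝ` (constant outside of the interval); it is only
used for its values on `[-h, 0]`. -/
def val {E : Type*} [TopologicalSpace E] (φ : C(Iv h, E)) : ℝ → E :=
  IccExtend (neg_le_zero' (h := h)) φ

variable (h) in
/-- The pairs `(φ, φ')` with `φ : [-h, 0] → E` continuously differentiable (one-sided derivatives
at the end points), with the norm `max |φ| + max |φ'|`. -/
def C1Sub (E : Type*) [NormedAddCommGroup E] [NormedSpace ℝ E] :
    Submodule ℝ (WithLp 1 (C(Iv h, E) × C(Iv h, E))) where
  carrier := {p | ∀ t : Iv h, HasDerivWithinAt (val p.fst) (p.snd t) (Icc (-h) 0) t}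
  add_mem' := by
    intro p q hp hq t
    exact (hp t).add (hq t)
  zero_mem' := by
    intro t
    exact hasDerivWithinAt_const _ _ (0 : E)
  smul_mem' := by
    intro c p hp t
    exact (hp t).const_smul c

variable (h) in
/-- The space `C¹([-h, 0], E)` of continuously differentiable maps, with norm
`max |φ| + max |φ'|`; a map `φ` is represented by the pair `(φ, φ')`. -/
abbrev C1 (E : Type*) [NormedAddCommGroup E] [NormedSpace ℝ E] : Type _ := C1Sub h E

variable {E E' : Type*} [NormedAddCommGroup E] [NormedSpace ℝ E]
  [NormedAddCommGroup E'] [NormedSpace ℝ E']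

/-- The inclusion of `C¹` into `C`. -/
def C1.fn (φ : C1 h E) : C(Iv h, E) := φ.1.fst

/-- The derivative `φ' ∈ C` of `φ ∈ C¹`. -/
def C1.der (φ : C1 h E) : C(Iv h, E) := φ.1.snd

/-- Composition of `φ ∈ C¹` with a continuous linear map. -/
def C1.map (A : E →L[ℝ] E') (φ : C1 h E) : C1 h E' :=
  ⟨WithLp.toLp 1 (A.compLeftContinuous ℝ (Iv h) φ.fn, A.compLeftContinuous ℝ (Iv h) φ.der),
    fun t => A.hasFDerivAt.comp_hasDerivWithinAt (t : ℝ) (φ.2 t)⟩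

/-- The linear map `ℝ → ℝⁿ`, `x ↦ x e_j`. -/
def axis {n : ℕ} (j : Fin n) : ℝ →L[ℝ] Eu (Fin n) :=
  ContinuousLinearMap.toSpanSingleton ℝ (EuclideanSpace.single j 1)

/-- The product `φ · e_j ∈ C_n` for `φ ∈ C`. -/
def mulAxis {n : ℕ} (φ : C(Iv h, ℝ)) (j : Fin n) : C(Iv h, Eu (Fin n)) :=
  (axis j).compLeftContinuous ℝ (Iv h) φ

/-- The component `φ_j ∈ C` of `φ ∈ C_n`. -/
def component {n : ℕ} (φ : C(Iv h, Eu (Fin n))) (j : Fin n) : C(Iv h, ℝ) :=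
  (EuclideanSpace.proj j : Eu (Fin n) →L[ℝ] ℝ).compLeftContinuous ℝ (Iv h) φ

/-- The product `c ⊙ χ ∈ C¹_n` with components `c_j χ_j`. -/
def odot {n : ℕ} (c : Eu (Fin n)) (χ : Fin n → C1 h ℝ) : C1 h (Eu (Fin n)) :=
  ∑ j, c j • C1.map (axis j) (χ j)

/-- The odd extension `Eφ` of `φ ∈ C` (meaningful on `[-2h, h]`). -/
def oddExt (φ : C(Iv h, ℝ)) (t : ℝ) : ℝ :=
  if t < -h then 2 * val φ (-h) - val φ (-t - 2 * h)
  else if t ≤ 0 then val φ t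
  else 2 * val φ 0 - val φ (-t)

variable {n k : ℕ}

/-- The vector `v ∈ ℝᵏⁿ` with components `Eφ_j (r_κ)`. -/
def hat (r : Eu (Fin k)) (φ : C(Iv h, Eu (Fin n))) : Eu (Fin k × Fin n) :=
  WithLp.toLp 2 fun i => oddExt (component φ i.2) (r i.1)

variable (h n) in
/-- The trivial solution manifold `X₀ = {χ ∈ C¹_n : χ'(0) = 0}`. -/
def X0 : Set (C1 h (Eu (Fin n))) := {χ | χ.der zeroPt = 0}

end spaces

/-- The cube `Iᵏ`. -/
def cube (k : ℕ) (I : Set ℝ) : Set (Eu (Fin k)) := {r | ∀ κ, r κ ∈ I}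

section systems

variable {h : ℝ} [Fact (0 < h)] {n k : ℕ} {F : Type*}

/-- `G(r, φ) = g((r, φ)^)`. -/
def G (g : Eu (Fin k × Fin n) → Eu (Fin n)) (r : Eu (Fin k)) (φ : C1 h (Eu (Fin n))) :
    Eu (Fin n) :=
  g (hat r φ.fn)

/-- `Δ(r, φ) = δ(r, Q(r, φ))`. -/
def Del (δ : Eu (Fin k) → F → Eu (Fin k)) (Q : Eu (Fin k) → C(Iv h, Eu (Fin n)) → F)
    (r : Eu (Fin k)) (φ : C1 h (Eu (Fin n))) : Eu (Fin k) :=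
  δ r (Q r φ.fn)

/-- The domain `𝒰` of `G` and `Δ`. -/
def dom (I : Set ℝ) (V : Set (Eu (Fin k × Fin n))) (W : Set F)
    (Q : Eu (Fin k) → C(Iv h, Eu (Fin n)) → F) : Set (Eu (Fin k) × C1 h (Eu (Fin n))) :=
  {p | p.1 ∈ cube k I ∧ hat p.1 p.2.fn ∈ V ∧ Q p.1 p.2.fn ∈ W}

/-- The solution manifold of `x'(t) = G(r(t), x_t)`, `0 = Δ(r(t), x_t)`:
all `(r, φ) ∈ 𝒰` with `φ'(0) = G(r, φ)`, `Δ(r, φ) = 0`, `det D₁Δ(r, φ) ≠ 0`. -/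
def solManifold (U : Set (Eu (Fin k) × C1 h (Eu (Fin n))))
    (G : Eu (Fin k) → C1 h (Eu (Fin n)) → Eu (Fin n))
    (Δ : Eu (Fin k) → C1 h (Eu (Fin n)) → Eu (Fin k)) :
    Set (Eu (Fin k) × C1 h (Eu (Fin n))) :=
  {p | p ∈ U ∧ p.2.der zeroPt = G p.1 p.2 ∧ Δ p.1 p.2 = 0 ∧
    (fderiv ℝ (fun s => Δ s p.2) p.1).det ≠ 0}

open Classical in
/-- The function `h_g : V → (0, ∞)`. -/
def hg (V : Set (Eu (Fin k × Fin n))) (g : Eu (Fin k × Fin n) → Eu (Fin n))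
    (v : Eu (Fin k × Fin n)) : ℝ :=
  (if V = univ then 1 else min 1 (Metric.infDist v Vᶜ)) /
    (6 * k * n * (1 + (⨆ i : (Fin k × Fin n) × Fin n,
        |fderiv ℝ g v (EuclideanSpace.single i.1 1) i.2|) + ⨆ j : Fin n, |g v j|))

/-- The maps `χ_{g,j} : Iᵏ × V → C¹`, `j = 1, …, n`, from which the transformation `T` is built:
continuously differentiable, with `Q_j(r, χ_{g,j}(r, v)) = 0` where `Q_j(r, φ) = Q(r, φ · e_j)`,
with `[χ_{g,j}(r, v)]'(0) = 1`, and with `χ_{g,j}` and its partial derivatives with respect to the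
components of `v` bounded by `h_g(v)` in the norm of `C`. -/
structure IsChi [Zero F] (I : Set ℝ) (V : Set (Eu (Fin k × Fin n)))
    (g : Eu (Fin k × Fin n) → Eu (Fin n)) (Q : Eu (Fin k) → C(Iv h, Eu (Fin n)) → F)
    (χ : Fin n → Eu (Fin k) → Eu (Fin k × Fin n) → C1 h ℝ) : Prop where
  contDiffOn : ∀ j, ContDiffOn ℝ 1
    (fun p : Eu (Fin k) × Eu (Fin k × Fin n) => χ j p.1 p.2) (cube k I ×ˢ V)
  null : ∀ j, ∀ r ∈ cube k I, ∀ v ∈ V, Q r (mulAxis (χ j r v).fn j) = 0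
  der_zero : ∀ j, ∀ r ∈ cube k I, ∀ v ∈ V, (χ j r v).der zeroPt = 1
  norm_le : ∀ j, ∀ r ∈ cube k I, ∀ v ∈ V, ‖(χ j r v).fn‖ ≤ hg V g v
  norm_partial_le : ∀ j, ∀ r ∈ cube k I, ∀ v ∈ V, ∀ i : Fin k × Fin n,
    ‖(fderiv ℝ (fun w => χ j r w) v (EuclideanSpace.single i 1)).fn‖ ≤ hg V g v

/-- `T(r, φ) = (r, A(r, φ))`, `A(r, φ) = φ - g(v) ⊙ χ_g(r, v)`, `v = (r, φ)^`. -/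
def T (g : Eu (Fin k × Fin n) → Eu (Fin n))
    (χ : Fin n → Eu (Fin k) → Eu (Fin k × Fin n) → C1 h ℝ)
    (p : Eu (Fin k) × C1 h (Eu (Fin n))) : Eu (Fin k) × C1 h (Eu (Fin n)) :=
  (p.1, p.2 - odot (g (hat p.1 p.2.fn)) fun j => χ j p.1 (hat p.1 p.2.fn))

/-- `S(r, v) = v - R(r, v)` with `R_ι(r, v) = g_j(v) E(χ_{g,j}(r, v))(r_κ)` for `ι = (κ, j)`. -/
def S (g : Eu (Fin k × Fin n) → Eu (Fin n))
    (χ : Fin n → Eu (Fin k) → Eu (Fin k × Fin n) → C1 h ℝ)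
    (r : Eu (Fin k)) (v : Eu (Fin k × Fin n)) : Eu (Fin k × Fin n) :=
  v - WithLp.toLp 2 fun i => g v i.2 * oddExt (χ i.2 r v).fn (r i.1)

/-- `𝒪 = {(r, ψ) ∈ Iᵏ × C¹_n : Q(r, ψ) ∈ W, (r, ψ)^ ∈ S_r(V)}`. -/
def codom (I : Set ℝ) (V : Set (Eu (Fin k × Fin n))) (W : Set F)
    (g : Eu (Fin k × Fin n) → Eu (Fin n)) (Q : Eu (Fin k) → C(Iv h, Eu (Fin n)) → F)
    (χ : Fin n → Eu (Fin k) → Eu (Fin k × Fin n) → C1 h ℝ) :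
    Set (Eu (Fin k) × C1 h (Eu (Fin n))) :=
  {p | p.1 ∈ cube k I ∧ Q p.1 p.2.fn ∈ W ∧ hat p.1 p.2.fn ∈ S g χ p.1 '' V}

end systems

/-- `f` restricts to a `C¹` diffeomorphism of the open set `A` onto the open set `B`. -/
def IsC1Diffeo {X Y : Type*} [NormedAddCommGroup X] [NormedSpace ℝ X]
    [NormedAddCommGroup Y] [NormedSpace ℝ Y] (f : X → Y) (A : Set X) (B : Set Y) : Prop :=
  IsOpen A ∧ IsOpen B ∧ ContDiffOn ℝ 1 f A ∧ MapsTo f A B ∧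
    ∃ f' : Y → X, ContDiffOn ℝ 1 f' B ∧ MapsTo f' B A ∧ InvOn f' f A B

end AlgDelay

end

noncomputable section

namespace AlgDelay

open Filter Topology

set_option linter.unusedSectionVars false

-- The problem reduces to finite dimension. For fixed r the map φ ↦ `hat r φ` is linear, and E acts
-- componentwise, so subtracting g(v) ⊙ χ(r, v) from φ moves v = `hat r φ` to S_r(v) (`hat_T`). Once
-- v can be recovered from S_r(v), the map T is inverted explicitly by φ = ψ + g(v) ⊙ χ(r, v) with
-- S_r(v) = `hat r ψ`.
--
-- The bound h_g is chosen so that v - S_r(v) is shorter than half of min(1, dist(v, Vᶜ)) and has a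
-- v-derivative of norm at most 1/2. The first property keeps the segment between two points with
-- the same image inside V, the second then forces these points to coincide (`injOn_S`). The
-- derivative of (r, v) ↦ (r, S_r(v)) is injective for the same reason, and the inverse function
-- theorem gives an open image and a C¹ inverse jointly in r and v (`exists_inverse_S`). Smoothness
-- passes to T because (t, φ) ↦ Eφ(t) is C¹ on (-2h, h) × C¹ (`contDiffOn_oddL`).
--
-- Admissible χ come from the curve t exp(μt): slope 1 at 0, sup norm O(1/μ), μ-derivative O(1/μ²).
-- A finite-rank correction puts it into the kernel of L without changing the slope
-- (`exists_curve_ker`), and μ = 1/e(v) with a small positive C¹ function e gives the required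
-- bounds (`exists_isChi`).
--
-- Finally, T preserves Lφ and r and replaces φ'(0) by φ'(0) - g(v). Hence the differential
-- condition becomes ψ'(0) = 0 and the algebraic one becomes r = -d(Lψ). The determinant condition
-- is automatic, since Δ = d(Lφ) + r has D₁Δ = id.

local instance C1.normedAddCommGroup {h : ℝ} [Fact (0 < h)] {E : Type*} [NormedAddCommGroup E]
    [NormedSpace ℝ E] : NormedAddCommGroup (C1 h E) := Submodule.normedAddCommGroup _

local instance C1.normedSpace {h : ℝ} [Fact (0 < h)] {E : Type*} [NormedAddCommGroup E]
    [NormedSpace ℝ E] : NormedSpace ℝ (C1 h E) := Submodule.normedSpace _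

/-! ### The normed space C¹ and its basic operators -/

section C1space

variable {h : ℝ} [hh : Fact (0 < h)]
variable {E E' : Type*} [NormedAddCommGroup E] [NormedSpace ℝ E]
  [NormedAddCommGroup E'] [NormedSpace ℝ E']

theorem C1.norm_eq (φ : C1 h E) : ‖φ‖ = ‖φ.fn‖ + ‖φ.der‖ :=
  WithLp.prod_norm_eq_of_L1 φ.1

theorem C1.norm_fn_le (φ : C1 h E) : ‖φ.fn‖ ≤ ‖φ‖ := by
  rw [C1.norm_eq]; linarith [norm_nonneg φ.der]

theorem C1.norm_der_le (φ : C1 h E) : ‖φ.der‖ ≤ ‖φ‖ := by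
  rw [C1.norm_eq]; linarith [norm_nonneg φ.fn]

theorem C1.ext {φ ψ : C1 h E} (h₁ : φ.fn = ψ.fn) (h₂ : φ.der = ψ.der) : φ = ψ :=
  Subtype.ext (WithLp.ofLp_injective 1 (Prod.ext h₁ h₂))

variable (h E) in
/-- The inclusion of `C¹` into `C` as a continuous linear map. -/
def fnL : C1 h E →L[ℝ] C(Iv h, E) :=
  (WithLp.fstL 1 ℝ C(Iv h, E) C(Iv h, E)).comp (C1Sub h E).subtypeL

variable (h E) in
/-- Differentiation `C¹ → C` as a continuous linear map. -/
def derL : C1 h E →L[ℝ] C(Iv h, E) :=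
  (WithLp.sndL 1 ℝ C(Iv h, E) C(Iv h, E)).comp (C1Sub h E).subtypeL

@[simp] theorem fnL_apply (φ : C1 h E) : fnL h E φ = φ.fn := rfl
@[simp] theorem derL_apply (φ : C1 h E) : derL h E φ = φ.der := rfl

theorem C1.norm_map_le (A : E →L[ℝ] E') (φ : C1 h E) : ‖C1.map A φ‖ ≤ ‖A‖ * ‖φ‖ := by
  have key : ∀ f : C(Iv h, E), ‖A.compLeftContinuous ℝ (Iv h) f‖ ≤ ‖A‖ * ‖f‖ := fun f =>
    (ContinuousMap.norm_le _ (by positivity)).2 fun t =>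
      (A.le_opNorm _).trans (by gcongr; exact f.norm_coe_le_norm t)
  rw [C1.norm_eq φ, mul_add]
  exact (C1.norm_eq _).trans_le (add_le_add (key φ.fn) (key φ.der))

/-- Composition with a continuous linear map, as a linear map on `C¹`. -/
def mapLin (A : E →L[ℝ] E') : C1 h E →ₗ[ℝ] C1 h E' where
  toFun := C1.map A
  map_add' φ ψ := by
    apply C1.ext
    · exact map_add (A.compLeftContinuous ℝ (Iv h)) φ.fn ψ.fn
    · exact map_add (A.compLeftContinuous ℝ (Iv h)) φ.der ψ.der
  map_smul' c φ := by
    apply C1.ext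
    · exact map_smul (A.compLeftContinuous ℝ (Iv h)) c φ.fn
    · exact map_smul (A.compLeftContinuous ℝ (Iv h)) c φ.der

/-- Composition with a continuous linear map, as a continuous linear map on `C¹`. -/
def mapL (A : E →L[ℝ] E') : C1 h E →L[ℝ] C1 h E' :=
  LinearMap.mkContinuous (mapLin (h := h) A) ‖A‖ fun φ => C1.norm_map_le A φ

theorem val_of_mem (φ : C(Iv h, E)) {t : ℝ} (ht : t ∈ Icc (-h) 0) : val φ t = φ ⟨t, ht⟩ :=
  IccExtend_of_mem _ _ ht

theorem continuous_val (φ : C(Iv h, E)) : Continuous (val φ) :=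
  φ.continuous.Icc_extend'

theorem C1.hasDerivWithinAt (φ : C1 h E) {t : ℝ} (ht : t ∈ Icc (-h) 0) :
    HasDerivWithinAt (val φ.fn) (val φ.der t) (Icc (-h) 0) t := by
  rw [val_of_mem _ ht]
  exact φ.2 ⟨t, ht⟩

theorem C1.mk_of_hasDerivAt (f f' : C(Iv h, E)) (F F' : ℝ → E)
    (hF : ∀ t ∈ Icc (-h) 0, HasDerivAt F (F' t) t)
    (hf : ∀ t : Iv h, f t = F t) (hf' : ∀ t : Iv h, f' t = F' t) :
    WithLp.toLp 1 (f, f') ∈ C1Sub h E := by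
  intro t
  have h1 : ∀ s ∈ Icc (-h) 0, val f s = F s := fun s hs => by rw [val_of_mem f hs, hf]
  have := ((hF t t.2).hasDerivWithinAt (s := Icc (-h) 0)).congr h1 (h1 t t.2)
  simpa [hf' t] using this

end C1space

/-! ### Smoothness of the odd extension and of the evaluation map `hat` -/

section oddExtension

variable {h : ℝ} [hh : Fact (0 < h)]

/-- Evaluation of `val φ` at `t`. -/
def valL (h : ℝ) [Fact (0 < h)] (t : ℝ) : C(Iv h, ℝ) →L[ℝ] ℝ :=
  ContinuousMap.evalCLM ℝ (projIcc (-h) 0 neg_le_zero' t)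

/-- Evaluation of the odd extension at `t`, as a continuous linear functional. -/
def oddL (h : ℝ) [Fact (0 < h)] (t : ℝ) : C(Iv h, ℝ) →L[ℝ] ℝ :=
  valL h t + (valL h (-h) - valL h (-t - 2 * h)) + (valL h 0 - valL h (-t))

theorem oddL_apply' (t : ℝ) (φ : C(Iv h, ℝ)) :
    oddL h t φ = val φ t + (val φ (-h) - val φ (-t - 2 * h)) + (val φ 0 - val φ (-t)) := rfl

theorem val_of_le (φ : C(Iv h, ℝ)) {t : ℝ} (ht : t ≤ -h) : val φ t = val φ (-h) := by
  rw [val, IccExtend_of_le_left _ _ ht, IccExtend_of_le_left _ _ le_rfl]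

theorem val_of_ge (φ : C(Iv h, ℝ)) {t : ℝ} (ht : 0 ≤ t) : val φ t = val φ 0 := by
  rw [val, IccExtend_of_right_le _ _ ht, IccExtend_of_right_le _ _ le_rfl]

/-- Because `val` is constant outside [-h, 0], in each of the three ranges of t the superfluous
terms of the sum cancel. One formula thus replaces the case distinction and makes linearity and
continuity in φ evident. -/
theorem oddExt_eq_oddL (φ : C(Iv h, ℝ)) (t : ℝ) : oddExt φ t = oddL h t φ := by
  have := hh.out
  rw [oddL_apply', oddExt]
  split_ifs with h1 h2
  · rw [val_of_le φ h1.le, val_of_ge φ (t := -t) (by linarith)]; ring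
  · rw [val_of_le φ (t := -t - 2 * h) (by linarith), val_of_ge φ (t := -t) (by linarith)]; ring
  · rw [val_of_ge φ (t := t) (by linarith), val_of_le φ (t := -t - 2 * h) (by linarith)]; ring

theorem abs_val_le (φ : C(Iv h, ℝ)) (t : ℝ) : |val φ t| ≤ ‖φ‖ := φ.norm_coe_le_norm _

theorem abs_oddL_le (t : ℝ) (φ : C(Iv h, ℝ)) : |oddL h t φ| ≤ 3 * ‖φ‖ := by
  have := hh.out
  rw [← oddExt_eq_oddL, oddExt]
  have key : ∀ x y : ℝ, |x| ≤ ‖φ‖ → |y| ≤ ‖φ‖ → |2 * x - y| ≤ 3 * ‖φ‖ := by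
    intro x y hx hy
    rw [abs_le] at *
    constructor <;> linarith
  split_ifs
  · exact key _ _ (abs_val_le _ _) (abs_val_le _ _)
  · linarith [abs_val_le φ t, norm_nonneg φ]
  · exact key _ _ (abs_val_le _ _) (abs_val_le _ _)

/-- The reflection of `[-2h, h]` onto `[-h, 0]` at the end points of `[-h, 0]`. -/
def fold (h t : ℝ) : ℝ := -|(|t + h| - h)|

theorem continuous_fold : Continuous (fold h) := by unfold fold; fun_prop

theorem fold_left {t : ℝ} (ht : t ∈ Icc (-(2 * h)) (-h)) : fold h t = -t - 2 * h := by
  have := hh.out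
  rw [fold, abs_of_nonpos (a := t + h) (by linarith [ht.2]),
    abs_of_nonpos (by linarith [ht.1])]; ring

theorem fold_mid {t : ℝ} (ht : t ∈ Icc (-h) 0) : fold h t = t := by
  rw [fold, abs_of_nonneg (a := t + h) (by linarith [ht.1]),
    abs_of_nonpos (by linarith [ht.2])]; ring

theorem fold_right {t : ℝ} (ht : t ∈ Icc 0 h) : fold h t = -t := by
  have := hh.out
  rw [fold, abs_of_nonneg (a := t + h) (by linarith [ht.1]),
    abs_of_nonneg (by linarith [ht.1])]; ring

theorem hasDerivWithinAt_oddL_left (φ : C1 h ℝ) {t : ℝ} (ht : t ∈ Icc (-(2 * h)) (-h)) :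
    HasDerivWithinAt (fun s => oddL h s φ.fn) (val φ.der (fold h t)) (Icc (-(2 * h)) (-h)) t := by
  have := hh.out
  have hm : MapsTo (fun s : ℝ => -s - 2 * h) (Icc (-(2 * h)) (-h)) (Icc (-h) 0) :=
    fun s hs => ⟨by dsimp only; linarith [hs.2], by dsimp only; linarith [hs.1]⟩
  have h1 : HasDerivWithinAt (fun s : ℝ => -s - 2 * h) (-1) (Icc (-(2 * h)) (-h)) t :=
    ((hasDerivAt_id t).neg.sub_const _).hasDerivWithinAt
  have h2 := (C1.hasDerivWithinAt φ (hm ht)).scomp t h1 hm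
  have h3 := h2.const_sub (2 * val φ.fn (-h))
  have heq : ∀ s ∈ Icc (-(2 * h)) (-h),
      oddL h s φ.fn = 2 * val φ.fn (-h) - (val φ.fn ∘ fun s : ℝ => -s - 2 * h) s := fun s hs => by
    rw [oddL_apply', val_of_le _ hs.2, val_of_ge φ.fn (t := -s) (by linarith [hs.2])]
    simp only [Function.comp]; ring
  refine (h3.congr heq (heq t ht)).congr_deriv ?_
  rw [fold_left ht]; simp

theorem hasDerivWithinAt_oddL_mid (φ : C1 h ℝ) {t : ℝ} (ht : t ∈ Icc (-h) 0) :
    HasDerivWithinAt (fun s => oddL h s φ.fn) (val φ.der (fold h t)) (Icc (-h) 0) t := by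
  have := hh.out
  have heq : ∀ s ∈ Icc (-h) 0, oddL h s φ.fn = val φ.fn s := fun s hs => by
    rw [oddL_apply', val_of_le φ.fn (t := -s - 2 * h) (by linarith [hs.1]),
      val_of_ge φ.fn (t := -s) (by linarith [hs.2])]
    ring
  refine ((C1.hasDerivWithinAt φ ht).congr heq (heq t ht)).congr_deriv ?_
  rw [fold_mid ht]

theorem hasDerivWithinAt_oddL_right (φ : C1 h ℝ) {t : ℝ} (ht : t ∈ Icc 0 h) :
    HasDerivWithinAt (fun s => oddL h s φ.fn) (val φ.der (fold h t)) (Icc 0 h) t := by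
  have := hh.out
  have hm : MapsTo (fun s : ℝ => -s) (Icc 0 h) (Icc (-h) 0) :=
    fun s hs => ⟨by dsimp only; linarith [hs.2], by dsimp only; linarith [hs.1]⟩
  have h1 : HasDerivWithinAt (fun s : ℝ => -s) (-1) (Icc 0 h) t :=
    (hasDerivAt_id t).neg.hasDerivWithinAt
  have h2 := (C1.hasDerivWithinAt φ (hm ht)).scomp t h1 hm
  have h3 := h2.const_sub (2 * val φ.fn 0)
  have heq : ∀ s ∈ Icc 0 h,
      oddL h s φ.fn = 2 * val φ.fn 0 - (val φ.fn ∘ fun s : ℝ => -s) s := fun s hs => by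
    rw [oddL_apply', val_of_ge _ hs.1, val_of_le φ.fn (t := -s - 2 * h) (by linarith [hs.1])]
    simp only [Function.comp]; ring
  refine (h3.congr heq (heq t ht)).congr_deriv ?_
  rw [fold_right ht]; simp

/-- On the reflected pieces the factor -1 of the reflection cancels the minus sign of the odd
extension, so each piece has derivative φ' ∘ `fold`. At the seams -h and 0 the one-sided derivatives
therefore agree and glue. -/
theorem hasDerivAt_oddL (φ : C1 h ℝ) {t : ℝ} (ht : t ∈ Ioo (-(2 * h)) h) :
    HasDerivAt (fun s => oddL h s φ.fn) (val φ.der (fold h t)) t := by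
  have hpos := hh.out
  rcases lt_trichotomy t (-h) with h1 | h1 | h1
  · exact (hasDerivWithinAt_oddL_left φ ⟨ht.1.le, h1.le⟩).hasDerivAt (Icc_mem_nhds ht.1 h1)
  · refine ((hasDerivWithinAt_oddL_left φ ⟨ht.1.le, h1.le⟩).union
      (hasDerivWithinAt_oddL_mid φ ⟨h1.ge, by linarith⟩)).hasDerivAt ?_
    rw [Icc_union_Icc_eq_Icc (by linarith) (by linarith)]
    exact Icc_mem_nhds ht.1 (by linarith)
  · rcases lt_trichotomy t 0 with h2 | h2 | h2
    · exact (hasDerivWithinAt_oddL_mid φ ⟨h1.le, h2.le⟩).hasDerivAt (Icc_mem_nhds h1 h2)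
    · refine ((hasDerivWithinAt_oddL_mid φ ⟨h1.le, h2.le⟩).union
        (hasDerivWithinAt_oddL_right φ ⟨h2.ge, ht.2.le⟩)).hasDerivAt ?_
      rw [Icc_union_Icc_eq_Icc (by linarith) (by linarith)]
      exact Icc_mem_nhds h1 ht.2
    · exact (hasDerivWithinAt_oddL_right φ ⟨h2.le, ht.2.le⟩).hasDerivAt (Icc_mem_nhds h2 ht.2)

/-- The functional `φ ↦ Eφ(t)` on `C¹` is Lipschitz in `t` with respect to the operator norm. -/
theorem norm_oddL_sub_le {s t : ℝ} (hs : s ∈ Ioo (-(2 * h)) h) (ht : t ∈ Ioo (-(2 * h)) h) :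
    ‖(oddL h s).comp (fnL h ℝ) - (oddL h t).comp (fnL h ℝ)‖ ≤ |s - t| := by
  refine ContinuousLinearMap.opNorm_le_bound _ (abs_nonneg _) fun φ => ?_
  have := (convex_Ioo (-(2 * h)) h).norm_image_sub_le_of_norm_hasDerivWithin_le
    (f := fun s => oddL h s φ.fn) (C := ‖φ‖)
    (fun x hx => (hasDerivAt_oddL φ hx).hasDerivWithinAt)
    (fun x _ => (abs_val_le _ _).trans (C1.norm_der_le φ)) ht hs
  rw [mul_comm]
  exact this

theorem continuous_val_uncurry : Continuous fun p : ℝ × C(Iv h, ℝ) => val p.2 p.1 := by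
  have : Continuous fun p : ℝ × C(Iv h, ℝ) => p.2 (projIcc (-h) 0 neg_le_zero' p.1) :=
    continuous_snd.eval (continuous_projIcc.comp continuous_fst)
  exact this

/-- A function of two variables with continuous partial derivatives is `C¹`. -/
theorem contDiffOn_one_of_partial {E₁ E₂ G : Type*} [NormedAddCommGroup E₁] [NormedSpace ℝ E₁]
    [NormedAddCommGroup E₂] [NormedSpace ℝ E₂] [NormedAddCommGroup G] [NormedSpace ℝ G]
    {s : Set (E₁ × E₂)} (hs : IsOpen s) {f : E₁ → E₂ → G} {f₁ : E₁ × E₂ → E₁ →L[ℝ] G}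
    {f₂ : E₁ × E₂ → E₂ →L[ℝ] G} (c₁ : ContinuousOn f₁ s) (c₂ : ContinuousOn f₂ s)
    (d₁ : ∀ p ∈ s, HasFDerivAt (f · p.2) (f₁ p) p.1)
    (d₂ : ∀ p ∈ s, HasFDerivAt (f p.1 ·) (f₂ p) p.2) :
    ContDiffOn ℝ 1 (fun p : E₁ × E₂ => f p.1 p.2) s := by
  have key : ∀ u ∈ s, HasStrictFDerivAt (fun p : E₁ × E₂ => f p.1 p.2)
      ((f₁ u).coprod (f₂ u)) u := by
    intro u hu
    refine hasStrictFDerivAt_uncurry_coprod (f := f) (f₁ := fun x y => f₁ (x, y))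
      (f₂ := fun x y => f₂ (x, y)) ?_ ?_ (c₁.continuousAt (hs.mem_nhds hu))
      (c₂.continuousAt (hs.mem_nhds hu))
    · filter_upwards [hs.mem_nhds hu] with v hv
      exact d₁ v hv
    · filter_upwards [hs.mem_nhds hu] with v hv
      exact d₂ v hv
  rw [show (1 : WithTop ℕ∞) = 0 + 1 by simp, contDiffOn_succ_iff_fderiv_of_isOpen hs]
  refine ⟨fun u hu => (key u hu).differentiableAt.differentiableWithinAt, by simp, ?_⟩
  rw [contDiffOn_zero]
  have : ContinuousOn (fun u => (f₁ u).coprod (f₂ u)) s :=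
    (ContinuousLinearMap.coprodEquivL (𝕜 := ℝ) (S := ℝ) (E := E₁) (F := E₂)
      (G := G)).continuous.comp_continuousOn (c₁.prodMk c₂)
  exact this.congr fun u hu => (key u hu).hasFDerivAt.fderiv

/-- The partial derivative in t is φ'(`fold h t`), jointly continuous in t and φ. The one in φ is
evaluation itself; it is norm-continuous in t only as a functional on C¹, by the mean value
inequality, and not on C. -/
theorem contDiffOn_oddL :
    ContDiffOn ℝ 1 (fun p : ℝ × C1 h ℝ => oddL h p.1 p.2.fn) (Ioo (-(2 * h)) h ×ˢ univ) := by
  have hopen : IsOpen (Ioo (-(2 * h)) h ×ˢ (univ : Set (C1 h ℝ))) := isOpen_Ioo.prod isOpen_univ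
  refine contDiffOn_one_of_partial hopen (f := fun t (φ : C1 h ℝ) => oddL h t φ.fn)
    (f₁ := fun p => ContinuousLinearMap.toSpanSingleton ℝ (val p.2.der (fold h p.1)))
    (f₂ := fun p => (oddL h p.1).comp (fnL h ℝ)) ?_ ?_ ?_ ?_
  · refine Continuous.continuousOn ?_
    refine (ContinuousLinearMap.toSpanSingletonCLE (𝕜 := ℝ) (E := ℝ)).continuous.comp ?_
    exact continuous_val_uncurry.comp
      ((continuous_fold.comp continuous_fst).prodMk ((derL h ℝ).continuous.comp continuous_snd))
  · have : ContinuousOn (fun t => (oddL h t).comp (fnL h ℝ)) (Ioo (-(2 * h)) h) := by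
      refine LipschitzOnWith.continuousOn (K := 1) (LipschitzOnWith.of_dist_le_mul ?_)
      intro s hs t ht
      rw [dist_eq_norm, Real.dist_eq, NNReal.coe_one, one_mul]
      exact norm_oddL_sub_le hs ht
    exact this.comp continuousOn_fst fun p hp => hp.1
  · exact fun p hp => (hasDerivAt_oddL p.2 hp.1).hasFDerivAt
  · exact fun p _ => ((oddL h p.1).comp (fnL h ℝ)).hasFDerivAt

variable {n k : ℕ}

theorem hat_apply (r : Eu (Fin k)) (φ : C(Iv h, Eu (Fin n))) (i : Fin k × Fin n) :
    hat r φ i = oddL h (r i.1) (component φ i.2) := oddExt_eq_oddL _ _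

/-- The map `φ ↦ (r, φ)^` as a linear map. -/
def hatL (r : Eu (Fin k)) : C(Iv h, Eu (Fin n)) →ₗ[ℝ] Eu (Fin k × Fin n) where
  toFun := hat r
  map_add' φ ψ := by
    ext i
    rw [PiLp.add_apply, hat_apply, hat_apply, hat_apply, ← map_add]; congr 1
  map_smul' c φ := by
    ext i
    rw [PiLp.smul_apply, hat_apply, hat_apply, RingHom.id_apply, ← map_smul]; congr 1

theorem contDiffOn_hat {I : Set ℝ} (hI : I ⊆ Ioo (-(2 * h)) h) :
    ContDiffOn ℝ 1 (fun p : Eu (Fin k) × C1 h (Eu (Fin n)) => hat p.1 p.2.fn)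
      (cube k I ×ˢ univ) := by
  rw [contDiffOn_euclidean]
  intro i
  have h1 : ContDiff ℝ 1 fun p : Eu (Fin k) × C1 h (Eu (Fin n)) =>
      (p.1 i.1, mapL (EuclideanSpace.proj i.2 : Eu (Fin n) →L[ℝ] ℝ) p.2) :=
    ((EuclideanSpace.proj i.1 : Eu (Fin k) →L[ℝ] ℝ).contDiff.comp contDiff_fst).prodMk
      ((mapL (EuclideanSpace.proj i.2 : Eu (Fin n) →L[ℝ] ℝ)).contDiff.comp contDiff_snd)
  exact (contDiffOn_oddL.comp h1.contDiffOn fun p hp => ⟨hI (hp.1 i.1), mem_univ _⟩).congr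
    fun p _ => hat_apply p.1 p.2.fn i

theorem isOpen_cube {I : Set ℝ} (hI : IsOpen I) : IsOpen (cube k I) := by
  have : cube k I = ⋂ κ, (fun r : Eu (Fin k) => r κ) ⁻¹' I := by ext; simp [cube]
  rw [this]
  exact isOpen_iInter_of_finite fun κ => hI.preimage (EuclideanSpace.proj κ).continuous

theorem odot_eq (c : Eu (Fin n)) (χ : Fin n → C1 h ℝ) :
    odot c χ = ∑ j, c j • mapL (axis j) (χ j) := rfl

theorem contDiffOn_odot {X : Type*} [NormedAddCommGroup X] [NormedSpace ℝ X] {s : Set X}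
    {c : X → Eu (Fin n)} {χ : Fin n → X → C1 h ℝ} (hc : ContDiffOn ℝ 1 c s)
    (hχ : ∀ j, ContDiffOn ℝ 1 (χ j) s) :
    ContDiffOn ℝ 1 (fun x => odot (c x) fun j => χ j x) s := by
  simp only [odot_eq]
  refine ContDiffOn.sum fun j _ => ?_
  exact (contDiffOn_euclidean.1 hc j).smul ((mapL (axis j)).contDiff.comp_contDiffOn (hχ j))

theorem mulAxis_apply (φ : C(Iv h, ℝ)) (j : Fin n) (t : Iv h) (i : Fin n) :
    mulAxis φ j t i = if i = j then φ t else 0 := by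
  have : mulAxis φ j t = φ t • EuclideanSpace.single j (1 : ℝ) := rfl
  simp [this]

theorem component_apply (φ : C(Iv h, Eu (Fin n))) (j : Fin n) (t : Iv h) :
    component φ j t = φ t j := rfl

theorem odot_fn (c : Eu (Fin n)) (χ : Fin n → C1 h ℝ) :
    (odot c χ).fn = ∑ j, c j • mulAxis (χ j).fn j := by
  rw [← fnL_apply, odot_eq, map_sum]
  simp only [map_smul]
  rfl

theorem odot_der (c : Eu (Fin n)) (χ : Fin n → C1 h ℝ) :
    (odot c χ).der = ∑ j, c j • mulAxis (χ j).der j := by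
  rw [← derL_apply, odot_eq, map_sum]
  simp only [map_smul]
  rfl

theorem odot_der_zeroPt (c : Eu (Fin n)) (χ : Fin n → C1 h ℝ)
    (h1 : ∀ j, (χ j).der zeroPt = 1) : (odot c χ).der zeroPt = c := by
  rw [odot_der]
  ext i
  simp [ContinuousMap.sum_apply, mulAxis_apply, h1]

theorem hat_odot (r : Eu (Fin k)) (c : Eu (Fin n)) (χ : Fin n → C1 h ℝ) :
    hat r (odot c χ).fn = WithLp.toLp 2 fun i => c i.2 * oddExt (χ i.2).fn (r i.1) := by
  ext i
  have : component (odot c χ).fn i.2 = c i.2 • (χ i.2).fn := by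
    rw [odot_fn]
    ext t
    simp [component_apply, ContinuousMap.sum_apply, mulAxis_apply]
  rw [hat_apply, this, map_smul]
  simp [oddExt_eq_oddL]

end oddExtension

/-! ### Positive C¹ functions below a given positive continuous function -/

/-- A bump function at a point of an open set, scaled below a given positive function together
with its derivative. -/
theorem exists_contDiff_bump_le {E : Type*} [NormedAddCommGroup E] [NormedSpace ℝ E]
    [FiniteDimensional ℝ E] {V : Set E} (hV : IsOpen V) {H : E → ℝ} (hH : ContinuousOn H V)
    (hpos : ∀ v ∈ V, 0 < H v) {x : E} (hx : x ∈ V) :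
    ∃ f : E → ℝ, ContDiff ℝ 1 f ∧ (∀ᶠ y in 𝓝 x, 0 < f y) ∧ (∀ y, 0 ≤ f y) ∧
      (∀ y, f y ≤ 1 ∧ ‖fderiv ℝ f y‖ ≤ 1) ∧ ∀ y ∈ V, f y ≤ H y ∧ ‖fderiv ℝ f y‖ ≤ H y := by
  obtain ⟨ε, hε, hεV⟩ := Metric.nhds_basis_closedBall.mem_iff.1 (hV.mem_nhds hx)
  let b : ContDiffBump x := ⟨ε / 2, ε, by linarith, by linarith⟩
  have hb1 : ContDiff ℝ 1 b := b.contDiff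
  have hcpt : IsCompact (Metric.closedBall x ε) := isCompact_closedBall x ε
  obtain ⟨z, hz, hzmin⟩ := hcpt.exists_isMinOn ⟨x, Metric.mem_closedBall_self hε.le⟩
    (hH.mono hεV)
  obtain ⟨M, hM⟩ := (b.hasCompactSupport.fderiv (𝕜 := ℝ)).exists_bound_of_continuous
    (hb1.continuous_fderiv (by simp))
  have hM0 : 0 ≤ M := (norm_nonneg _).trans (hM x)
  have hm : 0 < min (H z) 1 := lt_min (hpos z (hεV hz)) one_pos
  -- H z is the minimum of H on the ball supporting the bump and M bounds the derivative of the
  -- bump; division by 1 + M handles value and derivative at once.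
  set c : ℝ := min (H z) 1 / (1 + M) with hc
  have hc0 : 0 < c := by positivity
  have hcm : c ≤ min (H z) 1 := div_le_self hm.le (by linarith)
  have hcM : c * M ≤ min (H z) 1 := by
    rw [hc, div_mul_eq_mul_div, div_le_iff₀ (by linarith)]
    nlinarith
  have hfd : ∀ y, fderiv ℝ (fun y => c * b y) y = c • fderiv ℝ b y := fun y =>
    fderiv_const_mul (hb1.differentiable (by simp) y) c
  have hb0 : ∀ y, c * b y ≤ min (H z) 1 := fun y =>
    (mul_le_of_le_one_right hc0.le b.le_one).trans hcm
  have hd0 : ∀ y, ‖fderiv ℝ (fun y => c * b y) y‖ ≤ min (H z) 1 := fun y => by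
    rw [hfd, norm_smul, Real.norm_of_nonneg hc0.le]
    exact (mul_le_mul_of_nonneg_left (hM y) hc0.le).trans hcM
  refine ⟨fun y => c * b y, contDiff_const.mul hb1, ?_, fun y => mul_nonneg hc0.le b.nonneg,
    fun y => ⟨(hb0 y).trans (min_le_right _ _), (hd0 y).trans (min_le_right _ _)⟩, ?_⟩
  · filter_upwards [Metric.ball_mem_nhds x hε] with y hy
    exact mul_pos hc0 (b.pos_of_mem_ball hy)
  · intro y hy
    by_cases hyb : y ∈ Metric.closedBall x ε
    · have : min (H z) 1 ≤ H y := (min_le_left _ _).trans (hzmin hyb)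
      exact ⟨(hb0 y).trans this, (hd0 y).trans this⟩
    · have hts : y ∉ tsupport b := by rwa [b.tsupport_eq]
      have h1 : b y = 0 := image_eq_zero_of_notMem_tsupport hts
      have h2 : fderiv ℝ b y = 0 := by
        by_contra hne
        exact hts (support_fderiv_subset ℝ hne)
      simp only [hfd, h1, h2]
      simpa using (hpos y hy).le

/-- On an open set, a positive continuous function dominates a positive `C¹` function and its
derivative. -/
theorem exists_contDiff_pos_le {E : Type*} [NormedAddCommGroup E] [NormedSpace ℝ E]
    [FiniteDimensional ℝ E] {V : Set E} (hV : IsOpen V) {H : E → ℝ} (hH : ContinuousOn H V)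
    (hpos : ∀ v ∈ V, 0 < H v) :
    ∃ e : E → ℝ, ContDiff ℝ 1 e ∧ ∀ v ∈ V, 0 < e v ∧ e v ≤ H v ∧ ‖fderiv ℝ e v‖ ≤ H v := by
  have : ∀ x : V, ∃ f : E → ℝ, ContDiff ℝ 1 f ∧ (∀ᶠ y in 𝓝 (x : E), 0 < f y) ∧ (∀ y, 0 ≤ f y) ∧
      (∀ y, f y ≤ 1 ∧ ‖fderiv ℝ f y‖ ≤ 1) ∧ ∀ y ∈ V, f y ≤ H y ∧ ‖fderiv ℝ f y‖ ≤ H y :=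
    fun x => exists_contDiff_bump_le hV hH hpos x.2
  choose f hf hfpos hf0 hf1 hfH using this
  -- Lindelöf: countably many of the bumps suffice for positivity on all of V.
  obtain ⟨t, htc, ht⟩ := TopologicalSpace.isOpen_iUnion_countable
    (fun x : V => interior {y : E | 0 < f x y}) fun x => isOpen_interior
  have hcover : ∀ v ∈ V, ∃ x ∈ t, 0 < f x v := by
    intro v hv
    have h1 : v ∈ ⋃ x : V, interior {y : E | 0 < f x y} :=
      mem_iUnion.2 ⟨⟨v, hv⟩, mem_interior_iff_mem_nhds.2 (hfpos ⟨v, hv⟩)⟩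
    rw [← ht] at h1
    obtain ⟨x, hx, hxv⟩ := mem_iUnion₂.1 h1
    exact ⟨x, hx, (interior_subset : interior {y : E | 0 < f x y} ⊆ _) hxv⟩
  have := htc.toEncodable
  -- Positive weights of total mass c ≤ 1, so that the weighted sum inherits the bound H of every
  -- summand and of its derivative.
  obtain ⟨ε, hε, c, hc, hc1⟩ := posSumOfEncodable one_pos t
  have hc0 : 0 ≤ c := hc.nonneg fun i => (hε i).le
  let u : t → E → ℝ := fun i y => ε i * f i y
  have hu : ∀ i, ContDiff ℝ 1 (u i) := fun i => contDiff_const.mul (hf i)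
  have hud : ∀ i y, ‖fderiv ℝ (u i) y‖ = ε i * ‖fderiv ℝ (f i) y‖ := fun i y => by
    rw [show fderiv ℝ (u i) y = ε i • fderiv ℝ (f i) y from
      fderiv_const_mul ((hf i).differentiable (by simp) y) (ε i), norm_smul,
      Real.norm_of_nonneg (hε i).le]
  have hn : ∀ i y, ‖u i y‖ = ε i * f i y := fun i y =>
    Real.norm_of_nonneg (mul_nonneg (hε i).le (hf0 i y))
  have hsum : ∀ y, Summable fun i => u i y := fun y =>
    Summable.of_norm_bounded hc.summable fun i => by
      rw [hn]; exact mul_le_of_le_one_right (hε i).le (hf1 i y).1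
  refine ⟨fun y => ∑' i, u i y, ?_, fun v hv => ⟨?_, ?_, ?_⟩⟩
  -- Differentiating the series needs bounds on the whole space; these are the bounds by 1, since
  -- those by H hold only on V.
  · refine contDiff_tsum (N := 1) (v := fun _ => ε) hu (fun _ _ => hc.summable) ?_
    intro m i y hm
    have hm : m ≤ 1 := by exact_mod_cast hm
    interval_cases m
    · rw [norm_iteratedFDeriv_zero, hn]
      exact mul_le_of_le_one_right (hε i).le (hf1 i y).1
    · rw [norm_iteratedFDeriv_one, hud]
      exact mul_le_of_le_one_right (hε i).le (hf1 i y).2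
  · obtain ⟨x, hx, hxv⟩ := hcover v hv
    exact (hsum v).tsum_pos (fun i => mul_nonneg (hε i).le (hf0 i v)) ⟨x, hx⟩
      (mul_pos (hε _) hxv)
  · have h1 := tsum_of_norm_bounded (hc.mul_right (H v)) (f := fun i => u i v) fun i => by
      rw [hn]; exact mul_le_mul_of_nonneg_left (hfH i v hv).1 (hε i).le
    exact (le_abs_self _).trans (h1.trans (mul_le_of_le_one_left (hpos v hv).le hc1))
  · rw [fderiv_tsum_apply hc.summable (fun i => (hu i).differentiable (by simp))
      (fun i y => by
        rw [hud]; exact mul_le_of_le_one_right (hε i).le (hf1 i y).2) (hsum v)]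
    have h1 := tsum_of_norm_bounded (hc.mul_right (H v)) (f := fun i => fderiv ℝ (u i) v) fun i => by
      rw [hud]; exact mul_le_mul_of_nonneg_left (hfH i v hv).2 (hε i).le
    exact h1.trans (mul_le_of_le_one_left (hpos v hv).le hc1)

/-! ### A curve in C¹ with slope 1 at 0, small in C, in the kernel of a given operator -/

section curve

variable {h : ℝ} [hh : Fact (0 < h)]

/-- The primitive vanishing at `0` of a continuous function, as an element of `C¹`. -/
def primitive (u : C(Iv h, ℝ)) : C1 h ℝ :=
  ⟨WithLp.toLp 1 (⟨fun t => ∫ s in (0 : ℝ)..t, val u s,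
      (intervalIntegral.continuous_primitive
        (fun a b => (continuous_val u).intervalIntegrable a b) 0).comp continuous_subtype_val⟩, u),
    C1.mk_of_hasDerivAt _ _ (fun t => ∫ s in (0 : ℝ)..t, val u s) (val u)
      (fun t _ => (continuous_val u).integral_hasStrictDerivAt 0 t |>.hasDerivAt)
      (fun _ => rfl) fun t => (val_of_mem u t.2).symm⟩

theorem primitive_der (u : C(Iv h, ℝ)) : (primitive u).der = u := rfl

theorem primitive_fn (u : C(Iv h, ℝ)) (t : Iv h) :
    (primitive u).fn t = ∫ s in (0 : ℝ)..t, val u s := rfl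

theorem norm_primitive_le (u : C(Iv h, ℝ)) : ‖primitive u‖ ≤ (h + 1) * ‖u‖ := by
  have hpos := hh.out
  rw [C1.norm_eq, primitive_der, add_mul, one_mul]
  gcongr
  refine (ContinuousMap.norm_le _ (by positivity)).2 fun t => ?_
  rw [primitive_fn]
  refine (intervalIntegral.norm_integral_le_of_norm_le_const (C := ‖u‖)
    fun s _ => abs_val_le u s).trans ?_
  rw [mul_comm, sub_zero, abs_of_nonpos t.2.2]
  gcongr
  linarith [t.2.1]

variable (h) in
/-- `primitive` as a continuous linear map. -/
def primitiveL : C(Iv h, ℝ) →L[ℝ] C1 h ℝ :=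
  LinearMap.mkContinuous
    { toFun := primitive
      map_add' := fun u w => by
        apply C1.ext
        · ext t
          exact intervalIntegral.integral_add ((continuous_val u).intervalIntegrable _ _)
            ((continuous_val w).intervalIntegrable _ _)
        · rfl
      map_smul' := fun c u => by
        apply C1.ext
        · ext t
          exact intervalIntegral.integral_smul c (val u)
        · rfl } (h + 1) norm_primitive_le

variable (h) in
/-- The inclusion `[-h, 0] → ℝ`. -/
def inclusion : C(Iv h, ℝ) := ⟨Subtype.val, continuous_subtype_val⟩

variable (h) in
/-- The function `t ↦ t exp (μ t)` as an element of `C¹`. -/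
def expCurve (μ : ℝ) : C1 h ℝ :=
  primitiveL h (NormedSpace.exp (μ • inclusion h) * (1 + μ • inclusion h))

theorem exp_smul_inclusion (μ : ℝ) (t : Iv h) :
    NormedSpace.exp (μ • inclusion h) t = Real.exp (μ * t) := by
  have h1 := NormedSpace.map_exp (ContinuousMap.evalAlgHom ℝ ℝ t) (continuous_eval_const t)
    (μ • inclusion h)
  rw [Real.exp_eq_exp_ℝ]
  exact h1

/-- This is the reason for defining the curve as a primitive: its derivative is built from the
exponential of the Banach algebra C, which is analytic, and `primitiveL` is bounded from C to C¹. -/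
theorem contDiff_expCurve : ContDiff ℝ 1 (expCurve h) := by
  have h1 : ContDiff ℝ 1 fun μ : ℝ => μ • inclusion h := contDiff_id.smul contDiff_const
  have h2 : ContDiff ℝ 1 (NormedSpace.exp : C(Iv h, ℝ) → C(Iv h, ℝ)) :=
    AnalyticOnNhd.contDiff fun x _ => NormedSpace.exp_analytic (𝕂 := ℝ) x
  exact (primitiveL h).contDiff.comp ((h2.comp h1).mul (contDiff_const.add h1))

theorem expCurve_der (μ : ℝ) (t : Iv h) :
    (expCurve h μ).der t = Real.exp (μ * t) * (1 + μ * t) := by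
  rw [← exp_smul_inclusion]; rfl

theorem expCurve_fn (μ : ℝ) (t : Iv h) : (expCurve h μ).fn t = t * Real.exp (μ * t) := by
  have hpos := hh.out
  have h1 : (expCurve h μ).fn t = ∫ s in (0 : ℝ)..t, val (expCurve h μ).der s := rfl
  have hd : ∀ s : ℝ, HasDerivAt (fun s => s * Real.exp (μ * s))
      (Real.exp (μ * s) * (1 + μ * s)) s := fun s => by
    have := (hasDerivAt_id s).mul (((hasDerivAt_id s).const_mul μ).exp)
    refine this.congr_deriv ?_
    simp only [id]; ring
  have h2 : ∫ s in (0 : ℝ)..t, val (expCurve h μ).der s =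
      ∫ s in (0 : ℝ)..t, Real.exp (μ * s) * (1 + μ * s) := by
    refine intervalIntegral.integral_congr fun s hs => ?_
    rw [uIcc_of_ge t.2.2] at hs
    rw [val_of_mem _ ⟨t.2.1.trans hs.1, hs.2⟩, expCurve_der]
  rw [h1, h2, intervalIntegral.integral_eq_sub_of_hasDerivAt (fun s _ => hd s)
    ((by fun_prop : Continuous fun s : ℝ => Real.exp (μ * s) * (1 + μ * s)).intervalIntegrable _ _)]
  simp

theorem expCurve_der_zeroPt (μ : ℝ) : (expCurve h μ).der zeroPt = 1 := by
  rw [expCurve_der]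
  simp [zeroPt]

theorem hasDerivAt_expCurve (μ : ℝ) : HasDerivAt (expCurve h) (deriv (expCurve h) μ) μ :=
  (contDiff_expCurve.differentiable (by simp) μ).hasDerivAt

theorem deriv_expCurve_fn (μ : ℝ) (t : Iv h) :
    (deriv (expCurve h) μ).fn t = t ^ 2 * Real.exp (μ * t) := by
  have h1 := ((ContinuousMap.evalCLM ℝ t).comp
    (fnL h ℝ)).hasFDerivAt.comp_hasDerivAt μ (hasDerivAt_expCurve (h := h) μ)
  have h2 : HasDerivAt (fun μ : ℝ => t * Real.exp (μ * t)) ((deriv (expCurve h) μ).fn t) μ :=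
    h1.congr_of_eventuallyEq (Eventually.of_forall fun s => (expCurve_fn s t).symm)
  refine h2.unique (((((hasDerivAt_id μ).mul_const (t : ℝ)).exp).const_mul (t : ℝ)).congr_deriv ?_)
  simp only [id]; ring

/-- With x = -μt ≥ 0 this is x exp(-x) ≤ 1; the weaker constant 2 matches the bound for the
μ-derivative. -/
theorem norm_expCurve_fn_le {μ : ℝ} (hμ : 0 < μ) : ‖(expCurve h μ).fn‖ ≤ 2 / μ := by
  refine (ContinuousMap.norm_le _ (by positivity)).2 fun t => ?_
  rw [expCurve_fn, norm_mul, Real.norm_eq_abs, Real.norm_eq_abs, Real.abs_exp,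
    abs_of_nonpos t.2.2, le_div_iff₀ hμ]
  have h1 := Real.add_one_le_exp (-(μ * t))
  have h2 : Real.exp (μ * t) * Real.exp (-(μ * t)) = 1 := by rw [← Real.exp_add]; simp
  nlinarith [Real.exp_pos (μ * t)]

/-- With x = -μt ≥ 0 this is x² exp(-x) ≤ 2, from 1 + x + x²/2 ≤ exp(x). -/
theorem norm_deriv_expCurve_fn_le {μ : ℝ} (hμ : 0 < μ) :
    ‖(deriv (expCurve h) μ).fn‖ ≤ 2 / μ ^ 2 := by
  refine (ContinuousMap.norm_le _ (by positivity)).2 fun t => ?_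
  rw [deriv_expCurve_fn, norm_mul, Real.norm_eq_abs, Real.norm_eq_abs, Real.abs_exp,
    abs_of_nonneg (sq_nonneg _), le_div_iff₀ (by positivity)]
  have h0 : 0 ≤ -(μ * (t : ℝ)) := by nlinarith [t.2.2]
  have h1 := Real.quadratic_le_exp_of_nonneg h0
  have h2 : Real.exp (μ * t) * Real.exp (-(μ * t)) = 1 := by rw [← Real.exp_add]; simp
  nlinarith [Real.exp_pos (μ * t)]

/-- A continuous right inverse for the restriction of an operator of finite rank to the kernel of
a functional. -/
theorem exists_rightInverse_on_ker {E F : Type*} [NormedAddCommGroup E] [NormedSpace ℝ E]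
    [NormedAddCommGroup F] [NormedSpace ℝ F] [FiniteDimensional ℝ F] (D : E →L[ℝ] ℝ)
    (T : E →L[ℝ] F) :
    ∃ R : F →L[ℝ] E, (∀ y, D (R y) = 0) ∧
      ∀ y ∈ (LinearMap.ker D.toLinearMap).map T.toLinearMap, T (R y) = y := by
  let N := LinearMap.ker D.toLinearMap
  let B : N →ₗ[ℝ] F := T.toLinearMap.comp N.subtype
  -- A linear section over the range of the restriction, extended to F; continuity is free because F
  -- is finite-dimensional.
  obtain ⟨R₀, hR₀⟩ := LinearMap.exists_rightInverse_of_surjective B.rangeRestrict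
    B.range_rangeRestrict
  obtain ⟨R₁, hR₁⟩ := LinearMap.exists_extend R₀
  refine ⟨LinearMap.toContinuousLinearMap (N.subtype.comp R₁), fun y => (R₁ y).2, ?_⟩
  rintro _ ⟨x, hx, rfl⟩
  have h1 : R₁ (B ⟨x, hx⟩) = R₀ (B.rangeRestrict ⟨x, hx⟩) :=
    LinearMap.congr_fun hR₁ (B.rangeRestrict ⟨x, hx⟩)
  have h2 : B.rangeRestrict (R₀ (B.rangeRestrict ⟨x, hx⟩)) = B.rangeRestrict ⟨x, hx⟩ :=
    LinearMap.congr_fun hR₀ _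
  rw [← h1] at h2
  exact congrArg Subtype.val h2

/-- A finite-rank correction of `expCurve` in the kernel of a given operator. -/
theorem exists_curve_ker {F : Type*} [NormedAddCommGroup F] [NormedSpace ℝ F]
    [FiniteDimensional ℝ F] (A : C(Iv h, ℝ) →L[ℝ] F) :
    ∃ (Φ : ℝ → C1 h ℝ) (K : ℝ), 0 < K ∧ ContDiff ℝ 1 Φ ∧ ∀ μ, 0 < μ →
      A (Φ μ).fn = 0 ∧ (Φ μ).der zeroPt = 1 ∧ ‖(Φ μ).fn‖ ≤ K / μ ∧
      ‖(deriv Φ μ).fn‖ ≤ K / μ ^ 2 := by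
  let D : C1 h ℝ →L[ℝ] ℝ := (ContinuousMap.evalCLM ℝ (zeroPt : Iv h)).comp (derL h ℝ)
  let B : C1 h ℝ →L[ℝ] F := A.comp (fnL h ℝ)
  obtain ⟨R, hDR, hR⟩ := exists_rightInverse_on_ker D B
  have hD : ∀ μ, D (expCurve h μ) = 1 := expCurve_der_zeroPt
  have hcl : ∀ S : Submodule ℝ F, IsClosed (S : Set F) := fun S => S.closed_of_finiteDimensional
  -- the class of `B (expCurve μ)` modulo the image of `ker D` is constant and tends to zero
  have hrange : ∀ μ, B (expCurve h μ) ∈ (LinearMap.ker D.toLinearMap).map B.toLinearMap := by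
    intro μ
    have hmem : ∀ ν, B (expCurve h μ) - B (expCurve h ν) ∈
        (LinearMap.ker D.toLinearMap).map B.toLinearMap := fun ν =>
      ⟨expCurve h μ - expCurve h ν, by
        change D (expCurve h μ - expCurve h ν) = 0
        rw [map_sub, hD, hD, sub_self], map_sub B _ _⟩
    have hlim : Tendsto (fun ν => B (expCurve h ν)) atTop (𝓝 0) := by
      have h0 : Tendsto (fun ν => (expCurve h ν).fn) atTop (𝓝 0) := by
        refine squeeze_zero_norm' ?_ (tendsto_const_nhds.div_atTop tendsto_id (a := (2 : ℝ)))
        filter_upwards [eventually_gt_atTop 0] with ν hν using norm_expCurve_fn_le hν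
      have h1 := (A.continuous.tendsto 0).comp h0
      rwa [map_zero] at h1
    have hlim' := (tendsto_const_nhds (x := B (expCurve h μ))).sub hlim
    rw [sub_zero] at hlim'
    exact (hcl _).mem_of_tendsto hlim' (Eventually.of_forall hmem)
  -- The subtracted term lies in ker D, so P keeps the slope at 0, and it removes the value of B
  -- wherever that value lies in B(ker D).
  let P : C1 h ℝ →L[ℝ] C1 h ℝ := ContinuousLinearMap.id ℝ _ - R.comp B
  have hP : ∀ φ, P φ = φ - R (B φ) := fun φ => rfl
  -- B factors through C, so P is bounded for the norm of C alone. This is essential, as the curve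
  -- is small in C but not in C¹.
  have hPn : ∀ φ : C1 h ℝ, ‖(P φ).fn‖ ≤ (1 + ‖R‖ * ‖A‖) * ‖φ.fn‖ := by
    intro φ
    have h1 : (P φ).fn = φ.fn - (R (A φ.fn)).fn := map_sub (fnL h ℝ) _ _
    have h2 : ‖(R (A φ.fn)).fn‖ ≤ ‖R‖ * (‖A‖ * ‖φ.fn‖) :=
      (C1.norm_fn_le _).trans ((R.le_opNorm _).trans (by gcongr; exact A.le_opNorm _))
    rw [h1]
    calc _ ≤ ‖φ.fn‖ + ‖(R (A φ.fn)).fn‖ := norm_sub_le _ _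
      _ ≤ _ := by linarith
  have hderiv : ∀ μ, deriv (fun μ => P (expCurve h μ)) μ = P (deriv (expCurve h) μ) := fun μ =>
    (P.hasFDerivAt.comp_hasDerivAt μ (hasDerivAt_expCurve μ)).deriv
  have hK : 0 < 1 + ‖R‖ * ‖A‖ := by positivity
  refine ⟨fun μ => P (expCurve h μ), (1 + ‖R‖ * ‖A‖) * 2, by positivity,
    P.contDiff.comp contDiff_expCurve, fun μ hμ => ⟨?_, ?_, ?_, ?_⟩⟩
  · change B (P (expCurve h μ)) = 0
    rw [hP, map_sub, hR _ (hrange μ), sub_self]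
  · change D (P (expCurve h μ)) = 1
    rw [hP, map_sub, hDR, hD, sub_zero]
  · rw [mul_div_assoc]
    exact (hPn _).trans (mul_le_mul_of_nonneg_left (norm_expCurve_fn_le hμ) hK.le)
  · rw [hderiv, mul_div_assoc]
    exact (hPn _).trans (mul_le_mul_of_nonneg_left (norm_deriv_expCurve_fn_le hμ) hK.le)

end curve

/-! ### The bound h_g and the existence of admissible χ -/

section existence

variable {n k : ℕ} {V : Set (Eu (Fin k × Fin n))} {g : Eu (Fin k × Fin n) → Eu (Fin n)}

/-- The sum of the bounds of the partial derivatives and the values in the denominator of `hg`. -/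
def hgSum (g : Eu (Fin k × Fin n) → Eu (Fin n)) (v : Eu (Fin k × Fin n)) : ℝ :=
  1 + (⨆ i : (Fin k × Fin n) × Fin n,
        |fderiv ℝ g v (EuclideanSpace.single i.1 1) i.2|) + ⨆ j : Fin n, |g v j|

open Classical in
/-- The numerator of `hg`. -/
def hgNum (V : Set (Eu (Fin k × Fin n))) (v : Eu (Fin k × Fin n)) : ℝ :=
  if V = univ then 1 else min 1 (Metric.infDist v Vᶜ)

theorem hg_eq (V : Set (Eu (Fin k × Fin n))) (g : Eu (Fin k × Fin n) → Eu (Fin n))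
    (v : Eu (Fin k × Fin n)) : hg V g v = hgNum V v / (6 * k * n * hgSum g v) := rfl

theorem hgSum_pos (v : Eu (Fin k × Fin n)) : 0 < hgSum g v := by
  have h1 := Real.iSup_nonneg (f := fun i : (Fin k × Fin n) × Fin n =>
    |fderiv ℝ g v (EuclideanSpace.single i.1 1) i.2|) fun _ => abs_nonneg _
  have h2 := Real.iSup_nonneg (f := fun j : Fin n => |g v j|) fun _ => abs_nonneg _
  rw [hgSum]
  linarith

theorem one_add_add_le_hgSum (v : Eu (Fin k × Fin n)) (i : Fin k × Fin n) (j : Fin n) :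
    1 + |fderiv ℝ g v (EuclideanSpace.single i 1) j| + |g v j| ≤ hgSum g v := by
  have h1 := le_ciSup (f := fun i : (Fin k × Fin n) × Fin n =>
    |fderiv ℝ g v (EuclideanSpace.single i.1 1) i.2|) (finite_range _).bddAbove (i, j)
  have h2 := le_ciSup (f := fun j : Fin n => |g v j|) (finite_range _).bddAbove j
  rw [hgSum]
  dsimp only at h1 h2
  linarith

theorem hgNum_pos (hV : IsOpen V) {v : Eu (Fin k × Fin n)} (hv : v ∈ V) : 0 < hgNum V v := by
  rw [hgNum]
  split_ifs with hu
  · exact one_pos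
  · have hne : (Vᶜ).Nonempty := nonempty_compl.2 hu
    exact lt_min one_pos
      ((hV.isClosed_compl.notMem_iff_infDist_pos hne).1 fun h => h hv)

theorem continuous_hgNum : Continuous (hgNum V) := by
  unfold hgNum
  split_ifs
  · exact continuous_const
  · exact continuous_const.min (Metric.continuous_infDist_pt _)

theorem continuousOn_ciSup_fintype {ι X : Type*} [Finite ι] [Nonempty ι] [TopologicalSpace X]
    {s : Set X} {f : ι → X → ℝ} (hf : ∀ i, ContinuousOn (f i) s) :
    ContinuousOn (fun x => ⨆ i, f i x) s := by
  have := Fintype.ofFinite ι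
  simp only [← Finset.sup'_univ_eq_ciSup]
  exact ContinuousOn.finset_sup'_apply _ fun i _ => hf i

theorem continuousOn_hgSum (hn : 0 < n) (hk : 0 < k) (hV : IsOpen V) (hg : ContDiffOn ℝ 1 g V) :
    ContinuousOn (hgSum g) V := by
  have : Nonempty (Fin n) := ⟨⟨0, hn⟩⟩
  have : Nonempty (Fin k) := ⟨⟨0, hk⟩⟩
  unfold hgSum
  refine (continuousOn_const.add (continuousOn_ciSup_fintype fun i => ?_)).add
    (continuousOn_ciSup_fintype fun j => ?_)
  · exact ((EuclideanSpace.proj i.2 : Eu (Fin n) →L[ℝ] ℝ).continuous.comp_continuousOn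
      ((hg.continuousOn_fderiv_of_isOpen hV le_rfl).clm_apply continuousOn_const)).abs
  · exact ((EuclideanSpace.proj j : Eu (Fin n) →L[ℝ] ℝ).continuous.comp_continuousOn
      hg.continuousOn).abs

theorem hg_pos (hn : 0 < n) (hk : 0 < k) (hV : IsOpen V) {v : Eu (Fin k × Fin n)} (hv : v ∈ V) :
    0 < hg V g v := by
  rw [hg_eq]
  have := hgNum_pos hV hv
  have := hgSum_pos (g := g) v
  positivity

theorem continuousOn_hg (hn : 0 < n) (hk : 0 < k) (hV : IsOpen V) (hg : ContDiffOn ℝ 1 g V) :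
    ContinuousOn (AlgDelay.hg V g) V := by
  refine ContinuousOn.div continuous_hgNum.continuousOn
    (continuousOn_const.mul (continuousOn_hgSum hn hk hV hg)) fun v _ => ?_
  have := hgSum_pos (g := g) v
  positivity

variable {h : ℝ} [hh : Fact (0 < h)]

variable (h) in
/-- `φ ↦ φ · e_j` as a continuous linear map. -/
def mulAxisL (j : Fin n) : C(Iv h, ℝ) →L[ℝ] C(Iv h, Eu (Fin n)) :=
  (axis j).compLeftContinuous ℝ (Iv h)

/-- Take χ_j(r, v) = Φ_j(1/e_j(v)), independent of r, where e_j and its derivative are at most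
h_g/K_j. The norm is then at most K_j e_j. By the chain rule a partial derivative is at most e_j⁻² ·
(h_g/K_j) · K_j e_j² = h_g: the decay 1/μ² exactly offsets the derivative of 1/e_j. -/
theorem exists_isChi {F : Type*} [NormedAddCommGroup F] [NormedSpace ℝ F] [FiniteDimensional ℝ F]
    (hn : 0 < n) (hk : 0 < k) (hV : IsOpen V) (hg : ContDiffOn ℝ 1 g V) {I : Set ℝ}
    (L : C(Iv h, Eu (Fin n)) →L[ℝ] F) (Q : Eu (Fin k) → C(Iv h, Eu (Fin n)) → F)
    (hQ : ∀ r ∈ cube k I, ∀ φ, Q r φ = L φ) : ∃ χ, IsChi (h := h) I V g Q χ := by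
  choose Φ K hK hΦ hΦ' using fun j : Fin n => exists_curve_ker (L.comp (mulAxisL h j))
  choose e he he' using fun j => exists_contDiff_pos_le hV
    ((continuousOn_hg hn hk hV hg).div_const (K j)) fun v hv => div_pos (hg_pos hn hk hV hv) (hK j)
  have hinv : ∀ j, ∀ v ∈ V, HasFDerivAt (fun v => (e j v)⁻¹)
      (-(((e j v) ^ 2)⁻¹ • fderiv ℝ (e j) v)) v := fun j v hv => by
    have := (hasDerivAt_inv (he' j v hv).1.ne').comp_hasFDerivAt v
      ((he j).differentiable (by simp) v).hasFDerivAt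
    rwa [neg_smul] at this
  refine ⟨fun j _ v => Φ j (e j v)⁻¹, ?_, ?_, ?_, ?_, ?_⟩
  · intro j
    refine (hΦ j).comp_contDiffOn (((he j).comp contDiff_snd).contDiffOn.inv fun p hp => ?_)
    exact (he' j p.2 hp.2).1.ne'
  · intro j r hr v hv
    rw [hQ r hr]
    exact (hΦ' j _ (inv_pos.2 (he' j v hv).1)).1
  · intro j r hr v hv
    exact (hΦ' j _ (inv_pos.2 (he' j v hv).1)).2.1
  · intro j r hr v hv
    refine (hΦ' j _ (inv_pos.2 (he' j v hv).1)).2.2.1.trans ?_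
    rw [div_inv_eq_mul, mul_comm, ← le_div_iff₀ (hK j)]
    exact (he' j v hv).2.1
  · intro j r hr v hv i
    obtain ⟨h1, -, h2⟩ := he' j v hv
    have h3 := ((hΦ j).differentiable (by simp) (e j v)⁻¹).hasDerivAt.hasFDerivAt.comp v
      (hinv j v hv)
    have h4 : fderiv ℝ (fun w => Φ j (e j w)⁻¹) v (EuclideanSpace.single i 1) =
        (-(((e j v) ^ 2)⁻¹ * fderiv ℝ (e j) v (EuclideanSpace.single i 1))) •
          deriv (Φ j) (e j v)⁻¹ := by
      rw [show fderiv ℝ (fun w => Φ j (e j w)⁻¹) v = _ from h3.fderiv]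
      rfl
    have h5 : ‖fderiv ℝ (e j) v (EuclideanSpace.single i 1)‖ ≤ AlgDelay.hg V g v / K j := by
      refine ((fderiv ℝ (e j) v).le_opNorm _).trans ?_
      rw [PiLp.norm_single, norm_one, mul_one]
      exact h2
    have h6 := (hΦ' j _ (inv_pos.2 h1)).2.2.2
    have h7 : 0 < ((e j v) ^ 2)⁻¹ := by positivity
    rw [h4, ← fnL_apply, map_smul, norm_smul, norm_neg, norm_mul, Real.norm_of_nonneg h7.le,
      fnL_apply]
    rw [inv_pow] at h6
    calc _ ≤ ((e j v) ^ 2)⁻¹ * (AlgDelay.hg V g v / K j) * (K j / ((e j v) ^ 2)⁻¹) :=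
          mul_le_mul (mul_le_mul_of_nonneg_left h5 h7.le) h6 (norm_nonneg _)
            (mul_nonneg h7.le ((norm_nonneg _).trans h5))
      _ = AlgDelay.hg V g v := by
        have := (hK j).ne'
        have := h1.ne'
        field_simp

end existence

/-! ### Finite-dimensional inversion and matrix estimates -/

/-- A `C¹` injection with injective derivatives between open sets of a finite-dimensional space has
open image and `C¹` inverse. -/
theorem isOpen_image_contDiffOn_inverse {E : Type*} [NormedAddCommGroup E] [NormedSpace ℝ E]
    [FiniteDimensional ℝ E] {A : Set E} (hA : IsOpen A) {f : E → E} (hf : ContDiffOn ℝ 1 f A)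
    (hinj : InjOn f A) (hker : ∀ x ∈ A, ∀ w, fderiv ℝ f x w = 0 → w = 0) :
    IsOpen (f '' A) ∧ ∃ f' : E → E, ContDiffOn ℝ 1 f' (f '' A) ∧ LeftInvOn f' f A := by
  have := FiniteDimensional.complete ℝ E
  have main : ∀ x ∈ A, f '' A ∈ 𝓝 (f x) ∧
      ∀ f' : E → E, LeftInvOn f' f A → ContDiffAt ℝ 1 f' (f x) := by
    intro x hx
    have hxA := hA.mem_nhds hx
    have hfx : ContDiffAt ℝ 1 f x := hf.contDiffAt hxA
    let D : E ≃L[ℝ] E := (LinearEquiv.ofInjectiveEndo (fderiv ℝ f x).toLinearMap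
      ((injective_iff_map_eq_zero _).2 (hker x hx))).toContinuousLinearEquiv
    have hD : HasFDerivAt f (D : E →L[ℝ] E) x := (hfx.differentiableAt (by simp)).hasFDerivAt
    have hs : HasStrictFDerivAt f (D : E →L[ℝ] E) x := hfx.hasStrictFDerivAt' hD (by simp)
    refine ⟨by rw [← hs.map_nhds_eq_of_equiv]; exact image_mem_map hxA, fun f' hf' => ?_⟩
    have hloc := hfx.to_localInverse hD (by simp)
    refine hloc.congr_of_eventuallyEq ?_
    have hval : hfx.localInverse hD (by simp) (f x) = x := hfx.localInverse_apply_image hD (by simp)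
    have hmem : ∀ᶠ y in 𝓝 (f x), hfx.localInverse hD (by simp) y ∈ A :=
      hloc.continuousAt.eventually_mem (by rwa [hval])
    -- Near f x the local inverse takes values in A, where `f'` undoes f; hence `f'` agrees with it
    -- and inherits its smoothness.
    filter_upwards [hmem, hs.eventually_right_inverse] with y hy1 hy2
    have h3 : f (hfx.localInverse hD (by simp) y) = y := hy2
    have h4 := hf' hy1
    rwa [h3] at h4
  refine ⟨isOpen_iff_mem_nhds.2 ?_, Function.invFunOn f A, ?_, hinj.leftInvOn_invFunOn⟩
  · rintro _ ⟨x, hx, rfl⟩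
    exact (main x hx).1
  · rintro _ ⟨x, hx, rfl⟩
    exact ((main x hx).2 _ hinj.leftInvOn_invFunOn).contDiffWithinAt

theorem norm_le_sum_abs {ι : Type} [Fintype ι] [DecidableEq ι] (x : Eu ι) : ‖x‖ ≤ ∑ i, |x i| := by
  have hx : x = ∑ i, EuclideanSpace.single i (x i) := by
    ext j
    simp
  calc ‖x‖ = ‖∑ i, EuclideanSpace.single i (x i)‖ := by rw [← hx]
    _ ≤ ∑ i, ‖EuclideanSpace.single i (x i)‖ := norm_sum_le _ _
    _ = _ := by simp

/-- The operator norm of a matrix with small entries. -/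
theorem norm_apply_le_of_entries {ι : Type} [Fintype ι] [DecidableEq ι] (A : Eu ι →L[ℝ] Eu ι)
    {c : ℝ} (hc : 0 ≤ c) (hA : ∀ i j, |A (EuclideanSpace.single i 1) j| ≤ c) (w : Eu ι) :
    ‖A w‖ ≤ Fintype.card ι * c * ‖w‖ := by
  have hw : w = ∑ i, w i • EuclideanSpace.single i (1 : ℝ) := by
    ext j
    simp [Pi.single_apply]
  have h1 : ∀ j, |A w j| ≤ c * ∑ i, |w i| := by
    intro j
    have h2 : A w j = ∑ i, w i * A (EuclideanSpace.single i 1) j := by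
      conv_lhs => rw [hw]
      simp
    rw [h2, Finset.mul_sum]
    refine (Finset.abs_sum_le_sum_abs _ _).trans (Finset.sum_le_sum fun i _ => ?_)
    rw [abs_mul, mul_comm]
    exact mul_le_mul_of_nonneg_right (hA i j) (abs_nonneg _)
  -- Cauchy–Schwarz; a second factor `Fintype.card ι` comes from summing over the rows, which gives
  -- the square of the claimed constant.
  have h3 : (∑ i, |w i|) ^ 2 ≤ Fintype.card ι * ‖w‖ ^ 2 := by
    have := sq_sum_le_card_mul_sum_sq (s := Finset.univ) (f := fun i => |w i|)
    rw [EuclideanSpace.norm_sq_eq]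
    simpa using this
  refine abs_le_of_sq_le_sq' ?_ (by positivity) |>.2
  rw [EuclideanSpace.norm_sq_eq]
  calc ∑ j, ‖A w j‖ ^ 2 ≤ ∑ _j : ι, (c * ∑ i, |w i|) ^ 2 :=
        Finset.sum_le_sum fun j _ => pow_le_pow_left₀ (norm_nonneg _) (h1 j) 2
    _ = Fintype.card ι * c ^ 2 * (∑ i, |w i|) ^ 2 := by
        rw [Finset.sum_const, Finset.card_univ, nsmul_eq_mul]; ring
    _ ≤ Fintype.card ι * c ^ 2 * (Fintype.card ι * ‖w‖ ^ 2) := by gcongr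
    _ = _ := by ring

/-! ### The maps S_r as small perturbations of the identity -/

section shift

variable {h : ℝ} [hh : Fact (0 < h)] {n k : ℕ} {F : Type*}
  {V : Set (Eu (Fin k × Fin n))} {g : Eu (Fin k × Fin n) → Eu (Fin n)} {I : Set ℝ}
  {Q : Eu (Fin k) → C(Iv h, Eu (Fin n)) → F}
  {χ : Fin n → Eu (Fin k) → Eu (Fin k × Fin n) → C1 h ℝ}

/-- The difference `v - S_r(v)`. -/
def shift (g : Eu (Fin k × Fin n) → Eu (Fin n))
    (χ : Fin n → Eu (Fin k) → Eu (Fin k × Fin n) → C1 h ℝ) (r : Eu (Fin k))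
    (v : Eu (Fin k × Fin n)) : Eu (Fin k × Fin n) :=
  WithLp.toLp 2 fun i => g v i.2 * oddExt (χ i.2 r v).fn (r i.1)

theorem S_eq (r : Eu (Fin k)) (v : Eu (Fin k × Fin n)) : S g χ r v = v - shift g χ r v := rfl

theorem shift_apply (r : Eu (Fin k)) (v : Eu (Fin k × Fin n)) (i : Fin k × Fin n) :
    shift g χ r v i = g v i.2 * oddL h (r i.1) (χ i.2 r v).fn := by
  rw [← oddExt_eq_oddL]; rfl

theorem hgNum_le_one (v : Eu (Fin k × Fin n)) : hgNum V v ≤ 1 := by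
  rw [hgNum]
  split_ifs
  · exact le_rfl
  · exact min_le_left _ _

/-- Origin of the constant 6kn: a factor 3 pays for the odd extension (`abs_oddL_le`), a factor kn
for the number of coordinates, and the remaining 2 leaves the contraction constant 1/2. -/
theorem three_mul_hg_mul_hgSum (hn : 0 < n) (hk : 0 < k) (v : Eu (Fin k × Fin n)) :
    3 * hg V g v * hgSum g v = hgNum V v / (2 * k * n) := by
  have h1 := (hgSum_pos (g := g) v).ne'
  have h2 : (n : ℝ) ≠ 0 := by positivity
  have h3 : (k : ℝ) ≠ 0 := by positivity
  rw [hg_eq]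
  field_simp
  ring

variable [Zero F]

theorem norm_shift_lt (hn : 0 < n) (hk : 0 < k) (hV : IsOpen V) (hχ : IsChi I V g Q χ)
    {r : Eu (Fin k)} (hr : r ∈ cube k I) {v : Eu (Fin k × Fin n)} (hv : v ∈ V) :
    ‖shift g χ r v‖ < hgNum V v / 2 := by
  have : Nonempty (Fin n) := ⟨⟨0, hn⟩⟩
  have : Nonempty (Fin k) := ⟨⟨0, hk⟩⟩
  have hpos := hg_pos (g := g) hn hk hV hv
  have key : ∀ i, |shift g χ r v i| < hgNum V v / (2 * k * n) := by
    intro i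
    have h1 : |oddL h (r i.1) (χ i.2 r v).fn| ≤ 3 * hg V g v :=
      (abs_oddL_le _ _).trans (by linarith [hχ.norm_le i.2 r hr v hv])
    -- The summand 1 in `hgSum` makes the inequality strict.
    have h2 : |g v i.2| < hgSum g v := by
      have := one_add_add_le_hgSum (g := g) v i i.2
      linarith [abs_nonneg (fderiv ℝ g v (EuclideanSpace.single i 1) i.2)]
    rw [shift_apply, abs_mul, ← three_mul_hg_mul_hgSum (g := g) hn hk v]
    nlinarith [abs_nonneg (g v i.2)]
  calc _ ≤ ∑ i, |shift g χ r v i| := norm_le_sum_abs _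
    _ < ∑ _i : Fin k × Fin n, hgNum V v / (2 * k * n) :=
        Finset.sum_lt_sum_of_nonempty Finset.univ_nonempty fun i _ => key i
    _ = hgNum V v / 2 := by
      have h2 : (n : ℝ) ≠ 0 := by positivity
      have h3 : (k : ℝ) ≠ 0 := by positivity
      simp only [Finset.sum_const, Finset.card_univ, Fintype.card_prod, Fintype.card_fin,
        nsmul_eq_mul, Nat.cast_mul]
      field_simp

theorem contDiffOn_shift (hg : ContDiffOn ℝ 1 g V) (hI : I ⊆ Ioo (-(2 * h)) h)
    (hχ : IsChi I V g Q χ) :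
    ContDiffOn ℝ 1 (fun p : Eu (Fin k) × Eu (Fin k × Fin n) => shift g χ p.1 p.2)
      (cube k I ×ˢ V) := by
  rw [contDiffOn_euclidean]
  intro i
  have h1 : ContDiffOn ℝ 1 (fun p : Eu (Fin k) × Eu (Fin k × Fin n) => g p.2 i.2)
      (cube k I ×ˢ V) :=
    contDiffOn_euclidean.1 (hg.comp contDiff_snd.contDiffOn fun p hp => hp.2) i.2
  have h2 : ContDiffOn ℝ 1 (fun p : Eu (Fin k) × Eu (Fin k × Fin n) =>
      (p.1 i.1, χ i.2 p.1 p.2)) (cube k I ×ˢ V) :=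
    ((EuclideanSpace.proj i.1 : Eu (Fin k) →L[ℝ] ℝ).contDiff.comp contDiff_fst).contDiffOn.prodMk
      (hχ.contDiffOn i.2)
  refine (h1.mul (contDiffOn_oddL.comp h2 fun p hp => ⟨hI (hp.1 i.1), mem_univ _⟩)).congr ?_
  intro p _
  exact shift_apply p.1 p.2 i

theorem contDiffOn_shift_right (hg : ContDiffOn ℝ 1 g V) (hI : I ⊆ Ioo (-(2 * h)) h)
    (hχ : IsChi I V g Q χ) {r : Eu (Fin k)} (hr : r ∈ cube k I) :
    ContDiffOn ℝ 1 (shift g χ r) V :=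
  (contDiffOn_shift hg hI hχ).comp (contDiff_prodMk_right r).contDiffOn fun _ hv => ⟨hr, hv⟩

/-- By the product rule each matrix entry is at most 3 h_g (|g_j| + |∂g_j|), hence at most 1/(2kn);
a kn × kn matrix with such entries has norm at most 1/2. -/
theorem norm_fderiv_shift_le (hn : 0 < n) (hk : 0 < k) (hV : IsOpen V)
    (hg : ContDiffOn ℝ 1 g V) (hI : I ⊆ Ioo (-(2 * h)) h)
    (hχ : IsChi I V g Q χ) {r : Eu (Fin k)} (hr : r ∈ cube k I)
    {v : Eu (Fin k × Fin n)} (hv : v ∈ V) (w : Eu (Fin k × Fin n)) :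
    ‖fderiv ℝ (shift g χ r) v w‖ ≤ 1 / 2 * ‖w‖ := by
  have hvV := hV.mem_nhds hv
  have h2 : (n : ℝ) ≠ 0 := by positivity
  have h3 : (k : ℝ) ≠ 0 := by positivity
  have hpos := hg_pos (g := g) hn hk hV hv
  have hd := (((contDiffOn_shift_right hg hI hχ hr).contDiffAt hvV).differentiableAt
    (by simp)).hasFDerivAt
  have hgd := ((hg.contDiffAt hvV).differentiableAt (by simp)).hasFDerivAt
  have hχc : ∀ j, ContDiffOn ℝ 1 (χ j r) V := fun j =>
    (hχ.contDiffOn j).comp (contDiff_prodMk_right r).contDiffOn fun _ hv => ⟨hr, hv⟩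
  have hχd := fun j => (((hχc j).contDiffAt hvV).differentiableAt (by simp)).hasFDerivAt
  have entry : ∀ ι i : Fin k × Fin n,
      |fderiv ℝ (shift g χ r) v (EuclideanSpace.single ι 1) i| ≤ 1 / (2 * k * n) := by
    intro ι i
    have e1 := (EuclideanSpace.proj i : Eu (Fin k × Fin n) →L[ℝ] ℝ).hasFDerivAt.comp v hd
    have e2 := (EuclideanSpace.proj i.2 : Eu (Fin n) →L[ℝ] ℝ).hasFDerivAt.comp v hgd
    have e3 := ((oddL h (r i.1)).comp (fnL h ℝ)).hasFDerivAt.comp v (hχd i.2)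
    have e4 := e1.unique ((e2.mul e3).congr_of_eventuallyEq
      (Eventually.of_forall fun v => shift_apply r v i))
    have e5 : fderiv ℝ (shift g χ r) v (EuclideanSpace.single ι 1) i =
        g v i.2 * oddL h (r i.1) (fderiv ℝ (χ i.2 r) v (EuclideanSpace.single ι 1)).fn +
          oddL h (r i.1) (χ i.2 r v).fn * fderiv ℝ g v (EuclideanSpace.single ι 1) i.2 :=
      DFunLike.congr_fun e4 (EuclideanSpace.single ι 1)
    have b1 : |oddL h (r i.1) (χ i.2 r v).fn| ≤ 3 * AlgDelay.hg V g v :=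
      (abs_oddL_le _ _).trans (by linarith [hχ.norm_le i.2 r hr v hv])
    have b2 : |oddL h (r i.1) (fderiv ℝ (χ i.2 r) v (EuclideanSpace.single ι 1)).fn| ≤
        3 * AlgDelay.hg V g v :=
      (abs_oddL_le _ _).trans (by linarith [hχ.norm_partial_le i.2 r hr v hv ι])
    have b3 := one_add_add_le_hgSum (g := g) v ι i.2
    rw [e5]
    calc _ ≤ |g v i.2| * (3 * AlgDelay.hg V g v) +
          3 * AlgDelay.hg V g v * |fderiv ℝ g v (EuclideanSpace.single ι 1) i.2| := by
          refine (abs_add_le _ _).trans ?_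
          rw [abs_mul, abs_mul]
          gcongr
      _ ≤ 3 * AlgDelay.hg V g v * hgSum g v := by nlinarith
      _ = hgNum V v / (2 * k * n) := three_mul_hg_mul_hgSum hn hk v
      _ ≤ _ := by gcongr; exact hgNum_le_one v
  refine (norm_apply_le_of_entries _ (by positivity) entry w).trans (le_of_eq ?_)
  rw [Fintype.card_prod, Fintype.card_fin, Fintype.card_fin, Nat.cast_mul]
  field_simp

/-- If S_r(v) = S_r(w), then w - v is a difference of two shifts, hence shorter than the larger of
the two numerators of h_g. So the segment from v to w stays in V, and the Lipschitz constant 1/2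
along it gives |w - v| ≤ |w - v|/2. -/
theorem injOn_S (hn : 0 < n) (hk : 0 < k) (hV : IsOpen V) (hg : ContDiffOn ℝ 1 g V)
    (hI : I ⊆ Ioo (-(2 * h)) h) (hχ : IsChi I V g Q χ) {r : Eu (Fin k)} (hr : r ∈ cube k I) :
    InjOn (S g χ r) V := by
  have main : ∀ v ∈ V, ∀ w ∈ V, hgNum V w ≤ hgNum V v → S g χ r v = S g χ r w → v = w := by
    intro v hv w hw hle heq
    have hsub : w - v = shift g χ r w - shift g χ r v := by
      rw [S_eq, S_eq] at heq
      have : w = v - shift g χ r v + shift g χ r w := by rw [heq]; abel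
      conv_lhs => rw [this]
      abel
    have hlt : ‖w - v‖ < hgNum V v := by
      rw [hsub]
      have h1 := norm_shift_lt hn hk hV hχ hr hv
      have h2 := norm_shift_lt hn hk hV hχ hr hw
      linarith [norm_sub_le (shift g χ r w) (shift g χ r v)]
    have hseg : segment ℝ v w ⊆ V := by
      rw [hgNum] at hlt
      split_ifs at hlt with hu
      · rw [hu]; exact subset_univ _
      · refine ((convex_ball v _).segment_subset (Metric.mem_ball_self ?_) ?_).trans
          (Metric.ball_infDist_compl_subset (x := v))
        · exact (norm_nonneg _).trans_lt (hlt.trans_le (min_le_right _ _))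
        · rw [mem_ball_iff_norm]
          exact hlt.trans_le (min_le_right _ _)
    have hlip := (convex_segment v w).norm_image_sub_le_of_norm_fderiv_le (𝕜 := ℝ)
      (f := shift g χ r) (C := 1 / 2)
      (fun x hx => ((contDiffOn_shift_right hg hI hχ hr).contDiffAt
        (hV.mem_nhds (hseg hx))).differentiableAt (by simp))
      (fun x hx => ContinuousLinearMap.opNorm_le_bound _ (by norm_num)
        (norm_fderiv_shift_le hn hk hV hg hI hχ hr (hseg hx)))
      (left_mem_segment ℝ v w) (right_mem_segment ℝ v w)
    rw [← hsub] at hlip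
    have h0 : ‖w - v‖ = 0 := by linarith [norm_nonneg (w - v)]
    exact (sub_eq_zero.1 (norm_eq_zero.1 h0)).symm
  intro v hv w hw heq
  rcases le_total (hgNum V w) (hgNum V v) with hle | hle
  · exact main v hv w hw hle heq
  · exact (main w hw v hv hle heq.symm).symm

/-- Carrying r along makes the inverse C¹ in r as well. The derivative of (r, v) ↦ (r, S_r(v)) is
block triangular with diagonal blocks id and id - D`shift`, the latter injective because D`shift`
has norm at most 1/2. -/
theorem exists_inverse_S (hn : 0 < n) (hk : 0 < k) (hV : IsOpen V) (hg : ContDiffOn ℝ 1 g V)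
    (hIo : IsOpen I) (hI : I ⊆ Ioo (-(2 * h)) h) (hχ : IsChi I V g Q χ) :
    IsOpen {p : Eu (Fin k) × Eu (Fin k × Fin n) | p.1 ∈ cube k I ∧ p.2 ∈ S g χ p.1 '' V} ∧
    ∃ σ : Eu (Fin k) × Eu (Fin k × Fin n) → Eu (Fin k × Fin n),
      ContDiffOn ℝ 1 σ {p | p.1 ∈ cube k I ∧ p.2 ∈ S g χ p.1 '' V} ∧
      ∀ r ∈ cube k I, ∀ v ∈ V, σ (r, S g χ r v) = v := by
  let A : Set (Eu (Fin k) × Eu (Fin k × Fin n)) := cube k I ×ˢ V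
  let f : Eu (Fin k) × Eu (Fin k × Fin n) → Eu (Fin k) × Eu (Fin k × Fin n) :=
    fun p => (p.1, S g χ p.1 p.2)
  have hA : IsOpen A := (isOpen_cube hIo).prod hV
  have hS : ContDiffOn ℝ 1 (fun p : Eu (Fin k) × Eu (Fin k × Fin n) => S g χ p.1 p.2) A :=
    contDiff_snd.contDiffOn.sub (contDiffOn_shift hg hI hχ)
  have hf : ContDiffOn ℝ 1 f A := contDiff_fst.contDiffOn.prodMk hS
  have himage : f '' A = {p | p.1 ∈ cube k I ∧ p.2 ∈ S g χ p.1 '' V} := by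
    ext ⟨r, y⟩
    constructor
    · rintro ⟨⟨r', v⟩, ⟨hr, hv⟩, heq⟩
      obtain ⟨rfl, rfl⟩ := Prod.ext_iff.1 heq
      exact ⟨hr, v, hv, rfl⟩
    · rintro ⟨hr, v, hv, hy⟩
      exact ⟨(r, v), ⟨hr, hv⟩, Prod.ext rfl hy⟩
  have hinj : InjOn f A := by
    rintro ⟨r, v⟩ ⟨hr, hv⟩ ⟨r', w⟩ ⟨_, hw⟩ heq
    obtain ⟨h1, h2⟩ := Prod.ext_iff.1 heq
    dsimp only [f] at h1 h2
    subst h1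
    exact Prod.ext rfl (injOn_S hn hk hV hg hI hχ hr hv hw h2)
  have hker : ∀ p ∈ A, ∀ w, fderiv ℝ f p w = 0 → w = 0 := by
    rintro ⟨r, v⟩ ⟨hr, hv⟩ ⟨s, w⟩ h0
    have hd : HasFDerivAt f (fderiv ℝ f (r, v)) (r, v) :=
      ((hf.contDiffAt (hA.mem_nhds ⟨hr, hv⟩)).differentiableAt (by simp)).hasFDerivAt
    have hs : s = 0 := by
      have h1 := hd.fst.unique hasFDerivAt_fst
      have h2 := DFunLike.congr_fun h1 (s, w)
      have h3 : (fderiv ℝ f (r, v) (s, w)).1 = s := h2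
      rw [← h3, h0]; rfl
    subst hs
    have hsh := (((contDiffOn_shift_right hg hI hχ hr).contDiffAt
      (hV.mem_nhds hv)).differentiableAt (by simp)).hasFDerivAt
    have h1 : HasFDerivAt (S g χ r) ((ContinuousLinearMap.snd ℝ _ _).comp
        ((fderiv ℝ f (r, v)).comp (ContinuousLinearMap.inr ℝ _ _))) v :=
      hd.snd.comp v (hasFDerivAt_prodMk_right r v)
    have h2 : HasFDerivAt (S g χ r) (ContinuousLinearMap.id ℝ _ - fderiv ℝ (shift g χ r) v) v :=
      (hasFDerivAt_id v).sub hsh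
    have h3 : (fderiv ℝ f (r, v) (0, w)).2 = w - fderiv ℝ (shift g χ r) v w :=
      DFunLike.congr_fun (h1.unique h2) w
    rw [h0] at h3
    have h4 : w = fderiv ℝ (shift g χ r) v w := (sub_eq_zero.1 h3.symm)
    have h5 := norm_fderiv_shift_le hn hk hV hg hI hχ hr hv w
    rw [← h4] at h5
    have h6 : ‖w‖ = 0 := by linarith [norm_nonneg w]
    rw [norm_eq_zero.1 h6]; rfl
  obtain ⟨hopen, f', hf', hinv⟩ := isOpen_image_contDiffOn_inverse hA hf hinj hker
  rw [himage] at hopen hf'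
  exact ⟨hopen, fun p => (f' p).2, hf'.snd, fun r hr v hv =>
    congrArg Prod.snd (hinv (show (r, v) ∈ A from ⟨hr, hv⟩))⟩

end shift

/-! ### The transformation T and the image of the solution manifold -/

section transformation

variable {h : ℝ} [hh : Fact (0 < h)] {n k : ℕ} {F : Type*}
  [NormedAddCommGroup F] [NormedSpace ℝ F]
  {V : Set (Eu (Fin k × Fin n))} {g : Eu (Fin k × Fin n) → Eu (Fin n)} {I : Set ℝ} {W : Set F}
  {L : C(Iv h, Eu (Fin n)) →L[ℝ] F} {Q : Eu (Fin k) → C(Iv h, Eu (Fin n)) → F}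
  {χ : Fin n → Eu (Fin k) → Eu (Fin k × Fin n) → C1 h ℝ}

theorem hat_sub_odot (r : Eu (Fin k)) (φ : C1 h (Eu (Fin n))) (v : Eu (Fin k × Fin n)) :
    hat r (φ - odot (g v) fun j => χ j r v).fn = hat r φ.fn - shift g χ r v := by
  have h1 : (φ - odot (g v) fun j => χ j r v).fn =
    φ.fn - (odot (g v) fun j => χ j r v).fn := rfl
  have h2 := map_sub (hatL r) φ.fn (odot (g v) fun j => χ j r v).fn
  rw [h1]
  exact h2.trans (congrArg _ (hat_odot _ _ _))

theorem hat_add_odot (r : Eu (Fin k)) (φ : C1 h (Eu (Fin n))) (v : Eu (Fin k × Fin n)) :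
    hat r (φ + odot (g v) fun j => χ j r v).fn = hat r φ.fn + shift g χ r v := by
  have h1 : (φ + odot (g v) fun j => χ j r v).fn =
    φ.fn + (odot (g v) fun j => χ j r v).fn := rfl
  have h2 := map_add (hatL r) φ.fn (odot (g v) fun j => χ j r v).fn
  rw [h1]
  exact h2.trans (congrArg _ (hat_odot _ _ _))

theorem L_odot (hQ : ∀ r ∈ cube k I, ∀ φ, Q r φ = L φ) (hχ : IsChi I V g Q χ)
    {r : Eu (Fin k)} (hr : r ∈ cube k I) {v : Eu (Fin k × Fin n)} (hv : v ∈ V)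
    (c : Eu (Fin n)) : L (odot c fun j => χ j r v).fn = 0 := by
  rw [odot_fn, map_sum]
  refine Finset.sum_eq_zero fun j _ => ?_
  rw [map_smul, ← hQ r hr, hχ.null j r hr v hv, smul_zero]

theorem L_sub_odot (hQ : ∀ r ∈ cube k I, ∀ φ, Q r φ = L φ) (hχ : IsChi I V g Q χ)
    {r : Eu (Fin k)} (hr : r ∈ cube k I) {v : Eu (Fin k × Fin n)} (hv : v ∈ V)
    (φ : C1 h (Eu (Fin n))) : L (φ - odot (g v) fun j => χ j r v).fn = L φ.fn := by
  have h1 : (φ - odot (g v) fun j => χ j r v).fn =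
    φ.fn - (odot (g v) fun j => χ j r v).fn := rfl
  rw [h1, map_sub, L_odot hQ hχ hr hv, sub_zero]

theorem L_add_odot (hQ : ∀ r ∈ cube k I, ∀ φ, Q r φ = L φ) (hχ : IsChi I V g Q χ)
    {r : Eu (Fin k)} (hr : r ∈ cube k I) {v : Eu (Fin k × Fin n)} (hv : v ∈ V)
    (φ : C1 h (Eu (Fin n))) : L (φ + odot (g v) fun j => χ j r v).fn = L φ.fn := by
  have h1 : (φ + odot (g v) fun j => χ j r v).fn =
    φ.fn + (odot (g v) fun j => χ j r v).fn := rfl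
  rw [h1, map_add, L_odot hQ hχ hr hv, add_zero]

theorem T_der_zeroPt (hχ : IsChi I V g Q χ) {p : Eu (Fin k) × C1 h (Eu (Fin n))}
    (hp : p ∈ dom I V W Q) :
    (T g χ p).2.der zeroPt = p.2.der zeroPt - g (hat p.1 p.2.fn) := by
  have h1 : (T g χ p).2.der zeroPt = p.2.der zeroPt -
      (odot (g (hat p.1 p.2.fn)) fun j => χ j p.1 (hat p.1 p.2.fn)).der zeroPt := rfl
  rw [h1, odot_der_zeroPt _ _ fun j => hχ.der_zero j p.1 hp.1 _ hp.2.1]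

theorem L_T (hQ : ∀ r ∈ cube k I, ∀ φ, Q r φ = L φ) (hχ : IsChi I V g Q χ)
    {p : Eu (Fin k) × C1 h (Eu (Fin n))} (hp : p ∈ dom I V W Q) :
    L (T g χ p).2.fn = L p.2.fn := L_sub_odot hQ hχ hp.1 hp.2.1 p.2

/-- The link to finite dimension: T acts on the vectors v through S_r alone. -/
theorem hat_T (p : Eu (Fin k) × C1 h (Eu (Fin n))) :
    hat p.1 (T g χ p).2.fn = S g χ p.1 (hat p.1 p.2.fn) :=
  hat_sub_odot p.1 p.2 (hat p.1 p.2.fn)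

theorem mapsTo_T (hQ : ∀ r ∈ cube k I, ∀ φ, Q r φ = L φ) (hχ : IsChi I V g Q χ) :
    MapsTo (T g χ) (dom I V W Q) (codom I V W g Q χ) := by
  intro p hp
  refine ⟨hp.1, ?_, ?_⟩
  · change Q p.1 (T g χ p).2.fn ∈ W
    rw [hQ p.1 hp.1, L_T hQ hχ hp, ← hQ p.1 hp.1]
    exact hp.2.2
  · change hat p.1 (T g χ p).2.fn ∈ S g χ p.1 '' V
    rw [hat_T]
    exact mem_image_of_mem _ hp.2.1

theorem continuousOn_hat (hI : I ⊆ Ioo (-(2 * h)) h) :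
    ContinuousOn (fun p : Eu (Fin k) × C1 h (Eu (Fin n)) => hat p.1 p.2.fn)
      (cube k I ×ˢ univ) := (contDiffOn_hat hI).continuousOn

theorem continuous_L_snd :
    Continuous fun p : Eu (Fin k) × C1 h (Eu (Fin n)) => L p.2.fn :=
  (L.comp (fnL h _)).continuous.comp continuous_snd

theorem isOpen_dom (hIo : IsOpen I) (hI : I ⊆ Ioo (-(2 * h)) h) (hV : IsOpen V) (hW : IsOpen W)
    (hQ : ∀ r ∈ cube k I, ∀ φ, Q r φ = L φ) : IsOpen (dom I V W Q) := by
  have h1 := (continuousOn_hat (n := n) (k := k) hI).isOpen_inter_preimage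
    ((isOpen_cube hIo).prod isOpen_univ) hV
  convert h1.inter (hW.preimage (continuous_L_snd (L := L))) using 1
  ext p
  constructor
  · rintro ⟨hr, hv, hw⟩
    exact ⟨⟨⟨hr, mem_univ _⟩, hv⟩, by rwa [hQ _ hr] at hw⟩
  · rintro ⟨⟨⟨hr, _⟩, hv⟩, hw⟩
    exact ⟨hr, hv, by rwa [hQ _ hr]⟩

theorem isOpen_codom (hn : 0 < n) (hk : 0 < k) (hIo : IsOpen I) (hI : I ⊆ Ioo (-(2 * h)) h)
    (hV : IsOpen V) (hg : ContDiffOn ℝ 1 g V) (hW : IsOpen W)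
    (hQ : ∀ r ∈ cube k I, ∀ φ, Q r φ = L φ) (hχ : IsChi I V g Q χ) :
    IsOpen (codom I V W g Q χ) := by
  have h1 := (continuousOn_fst.prodMk (continuousOn_hat (n := n) (k := k) hI)).isOpen_inter_preimage
    ((isOpen_cube hIo).prod isOpen_univ) (exists_inverse_S hn hk hV hg hIo hI hχ).1
  convert h1.inter (hW.preimage (continuous_L_snd (L := L))) using 1
  ext p
  constructor
  · rintro ⟨hr, hw, hv⟩
    exact ⟨⟨⟨hr, mem_univ _⟩, hr, hv⟩, by rwa [hQ _ hr] at hw⟩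
  · rintro ⟨⟨⟨hr, _⟩, _, hv⟩, hw⟩
    exact ⟨hr, by rwa [hQ _ hr], hv⟩

theorem contDiffOn_T (hI : I ⊆ Ioo (-(2 * h)) h) (hg : ContDiffOn ℝ 1 g V)
    (hχ : IsChi I V g Q χ) : ContDiffOn ℝ 1 (T g χ) (dom I V W Q) := by
  have hhat : ContDiffOn ℝ 1 (fun p : Eu (Fin k) × C1 h (Eu (Fin n)) => hat p.1 p.2.fn)
      (dom I V W Q) := (contDiffOn_hat hI).mono fun p hp => ⟨hp.1, mem_univ _⟩
  refine contDiff_fst.contDiffOn.prodMk (contDiff_snd.contDiffOn.sub (contDiffOn_odot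
    (hg.comp hhat fun p hp => hp.2.1) fun j => ?_))
  exact (hχ.contDiffOn j).comp (contDiff_fst.contDiffOn.prodMk hhat) fun p hp => ⟨hp.1, hp.2.1⟩

/-- For (r, ψ) in the codomain set ν = S_r⁻¹(`hat r ψ`), which is C¹ in (r, ψ). Adding g(ν) ⊙ χ(r,
ν) to ψ produces a function whose `hat` is again ν, so this addition undoes the subtraction made by
T. -/
theorem isC1Diffeo_T (hn : 0 < n) (hk : 0 < k) (hIo : IsOpen I) (hI : I ⊆ Ioo (-(2 * h)) h)
    (hV : IsOpen V) (hg : ContDiffOn ℝ 1 g V) (hW : IsOpen W)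
    (hQ : ∀ r ∈ cube k I, ∀ φ, Q r φ = L φ) (hχ : IsChi I V g Q χ) :
    IsC1Diffeo (T g χ) (dom I V W Q) (codom I V W g Q χ) := by
  obtain ⟨-, σ, hσ, hσS⟩ := exists_inverse_S hn hk hV hg hIo hI hχ
  let ν : Eu (Fin k) × C1 h (Eu (Fin n)) → Eu (Fin k × Fin n) := fun p => σ (p.1, hat p.1 p.2.fn)
  have hνV : ∀ p ∈ codom I V W g Q χ, ν p ∈ V ∧ S g χ p.1 (ν p) = hat p.1 p.2.fn := by
    rintro p ⟨hr, -, v, hv, hvp⟩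
    have : ν p = v := by
      change σ (p.1, hat p.1 p.2.fn) = v
      rw [← hvp, hσS p.1 hr v hv]
    rw [this]
    exact ⟨hv, hvp⟩
  have hν : ContDiffOn ℝ 1 ν (codom I V W g Q χ) := by
    have hhat : ContDiffOn ℝ 1 (fun p : Eu (Fin k) × C1 h (Eu (Fin n)) => hat p.1 p.2.fn)
      (codom I V W g Q χ) := (contDiffOn_hat hI).mono fun p hp => ⟨hp.1, mem_univ _⟩
    exact hσ.comp (contDiff_fst.contDiffOn.prodMk hhat) fun p hp => ⟨hp.1, hp.2.2⟩
  have hhat : ∀ p ∈ codom I V W g Q χ,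
      hat p.1 (p.2 + odot (g (ν p)) fun j => χ j p.1 (ν p)).fn = ν p := by
    intro p hp
    rw [hat_add_odot, ← (hνV p hp).2, S_eq, sub_add_cancel]
  refine ⟨isOpen_dom hIo hI hV hW hQ, isOpen_codom hn hk hIo hI hV hg hW hQ hχ,
    contDiffOn_T hI hg hχ, mapsTo_T hQ hχ,
    fun p => (p.1, p.2 + odot (g (ν p)) fun j => χ j p.1 (ν p)), ?_, ?_, ?_, ?_⟩
  · refine contDiff_fst.contDiffOn.prodMk (contDiff_snd.contDiffOn.add (contDiffOn_odot
      (hg.comp hν fun p hp => (hνV p hp).1) fun j => ?_))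
    exact (hχ.contDiffOn j).comp (contDiff_fst.contDiffOn.prodMk hν)
      fun p hp => ⟨hp.1, (hνV p hp).1⟩
  · intro p hp
    refine ⟨hp.1, ?_, ?_⟩
    · dsimp only
      rw [hhat p hp]
      exact (hνV p hp).1
    · dsimp only
      rw [hQ p.1 hp.1, L_add_odot hQ hχ hp.1 (hνV p hp).1, ← hQ p.1 hp.1]
      exact hp.2.1
  · intro p hp
    have h1 : ν (T g χ p) = hat p.1 p.2.fn := by
      change σ (p.1, hat p.1 (T g χ p).2.fn) = _
      rw [hat_T, hσS p.1 hp.1 _ hp.2.1]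
    refine Prod.ext rfl ?_
    dsimp only
    rw [h1]
    exact sub_add_cancel _ _
  · intro p hp
    refine Prod.ext rfl ?_
    dsimp only [T]
    rw [hhat p hp]
    exact add_sub_cancel_right _ _

theorem image_solManifold (hn : 0 < n) (hk : 0 < k) (hIo : IsOpen I) (hI : I ⊆ Ioo (-(2 * h)) h)
    (hV : IsOpen V) (hg : ContDiffOn ℝ 1 g V) (hW : IsOpen W)
    (hQ : ∀ r ∈ cube k I, ∀ φ, Q r φ = L φ) (hχ : IsChi I V g Q χ)
    {d : F → Eu (Fin k)} {δ : Eu (Fin k) → F → Eu (Fin k)}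
    (hδ : ∀ r ∈ cube k I, ∀ w ∈ W, δ r w = d w + r) :
    T g χ '' solManifold (dom I V W Q) (G g) (Del δ Q) =
      {p | p ∈ (cube k I ×ˢ X0 h n) ∩ codom I V W g Q χ ∧ p.1 = -d (L p.2.fn)} := by
  have hΔ : ∀ φ : C1 h (Eu (Fin n)), L φ.fn ∈ W → ∀ r ∈ cube k I,
      Del δ Q r φ = d (L φ.fn) + r := fun φ hφ r hr => by
    rw [Del, hQ r hr, hδ r hr _ hφ]
  have hdet : ∀ p ∈ dom I V W Q, (fderiv ℝ (fun s => Del δ Q s p.2) p.1).det ≠ 0 := by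
    intro p hp
    have hw : L p.2.fn ∈ W := by rw [← hQ p.1 hp.1]; exact hp.2.2
    have h1 : HasFDerivAt (fun s => Del δ Q s p.2) (ContinuousLinearMap.id ℝ (Eu (Fin k))) p.1 := by
      refine ((hasFDerivAt_id p.1).const_add (d (L p.2.fn))).congr_of_eventuallyEq ?_
      -- The formula for Δ holds only over the cube; its openness suffices, since the derivative
      -- depends only on values near the point.
      filter_upwards [(isOpen_cube hIo).mem_nhds hp.1] with s hs
      exact hΔ p.2 hw s hs
    rw [h1.fderiv]
    simp [ContinuousLinearMap.det]
  obtain ⟨-, -, -, -, f', -, hf', hinv⟩ := isC1Diffeo_T hn hk hIo hI hV hg hW hQ hχ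
  have hL : ∀ p ∈ dom I V W Q, L p.2.fn ∈ W := fun p hp => by
    rw [← hQ p.1 hp.1]; exact hp.2.2
  ext q
  constructor
  · rintro ⟨p, ⟨hp, h1, h2, -⟩, rfl⟩
    refine ⟨⟨⟨hp.1, ?_⟩, mapsTo_T hQ hχ hp⟩, ?_⟩
    · change (T g χ p).2.der zeroPt = 0
      rw [T_der_zeroPt hχ hp, h1]
      exact sub_self _
    · rw [L_T hQ hχ hp]
      rw [hΔ p.2 (hL p hp) p.1 hp.1] at h2
      exact (neg_eq_of_add_eq_zero_right h2).symm
  · rintro ⟨⟨⟨hr, h0⟩, hq⟩, hd⟩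
    obtain ⟨p, hp, rfl⟩ : ∃ p ∈ dom I V W Q, T g χ p = q := ⟨f' q, hf' hq, hinv.2 hq⟩
    refine ⟨p, ⟨hp, ?_, ?_, hdet p hp⟩, rfl⟩
    · have h1 : (T g χ p).2.der zeroPt = 0 := h0
      rw [T_der_zeroPt hχ hp] at h1
      exact sub_eq_zero.1 h1
    · rw [L_T hQ hχ hp] at hd
      have hd' : p.1 = -d (L p.2.fn) := hd
      rw [hΔ p.2 (hL p hp) p.1 hp.1]
      conv_lhs => rw [hd']
      exact add_neg_cancel _

end transformation

end AlgDelay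

end

theorem corollary5p1 {h : ℝ} [Fact (0 < h)] {n k : ℕ} (hn : 0 < n) (hk : 0 < k)
    {F : Type*} [NormedAddCommGroup F] [NormedSpace ℝ F] [FiniteDimensional ℝ F]
    -- the data of the equation x'(t) = g(x(t - d₁(L x_t)), …, x(t - d_k(L x_t)))
    (V : Set (AlgDelay.Eu (Fin k × Fin n))) (hV : IsOpen V)
    (g : AlgDelay.Eu (Fin k × Fin n) → AlgDelay.Eu (Fin n)) (hg : ContDiffOn ℝ 1 g V)
    (L : C(AlgDelay.Iv h, AlgDelay.Eu (Fin n)) →L[ℝ] F)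
    (W : Set F) (hW : IsOpen W)
    (d : F → AlgDelay.Eu (Fin k)) (hd : ContDiffOn ℝ 1 d W)
    (hd_mem : ∀ w ∈ W, ∀ κ, d w κ ∈ Set.Icc 0 h)
    (hne : ∃ φ : AlgDelay.C1 h (AlgDelay.Eu (Fin n)), L φ.fn ∈ W ∧
      WithLp.toLp 2 (fun i : Fin k × Fin n => AlgDelay.val φ.fn (-(d (L φ.fn) i.1)) i.2) ∈ V)
    -- the open interval I and the larger compact interval J = [a, b]
    (I : Set ℝ) (hI : IsOpen I) (hI_conn : I.OrdConnected) (hI_sup : Set.Icc (-h) 0 ⊆ I)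
    (a b : ℝ) (hIJ : I ⊆ Set.Icc a b) (hJ : Set.Icc a b ⊆ Set.Icc (-(2 * h)) h)
    -- the associated algebraic-delay system
    (Q : AlgDelay.Eu (Fin k) → C(AlgDelay.Iv h, AlgDelay.Eu (Fin n)) → F)
    (hQ : ∀ r ∈ AlgDelay.cube k (Set.Icc a b), ∀ φ, Q r φ = L φ)
    (δ : AlgDelay.Eu (Fin k) → F → AlgDelay.Eu (Fin k))
    (hδ : ∀ r ∈ AlgDelay.cube k (Set.Icc a b), ∀ w ∈ W, δ r w = d w + r) :
    (∃ χ, AlgDelay.IsChi I V g Q χ) ∧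
    ∀ χ, AlgDelay.IsChi I V g Q χ →
      AlgDelay.IsC1Diffeo (AlgDelay.T g χ) (AlgDelay.dom I V W Q)
        (AlgDelay.codom I V W g Q χ) ∧
      AlgDelay.T g χ ''
          AlgDelay.solManifold (AlgDelay.dom I V W Q) (AlgDelay.G g) (AlgDelay.Del δ Q) =
        {p | p ∈ (AlgDelay.cube k I ×ˢ AlgDelay.X0 h n) ∩ AlgDelay.codom I V W g Q χ ∧
          p.1 = -d (L p.2.fn)} := by
  -- Openness of I excludes the end points of [-2h, h], so two-sided derivatives of the odd
  -- extension are available on I.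
  have hI' : I ⊆ Set.Ioo (-(2 * h)) h := by
    rw [← interior_Icc]
    exact interior_maximal (hIJ.trans hJ) hI
  have hcube : AlgDelay.cube k I ⊆ AlgDelay.cube k (Set.Icc a b) := fun r hr κ => hIJ (hr κ)
  have hQ' : ∀ r ∈ AlgDelay.cube k I, ∀ φ, Q r φ = L φ := fun r hr => hQ r (hcube hr)
  exact ⟨AlgDelay.exists_isChi hn hk hV hg L Q hQ', fun χ hχ =>
    ⟨AlgDelay.isC1Diffeo_T hn hk hI hI' hV hg hW hQ' hχ,
      AlgDelay.image_solManifold hn hk hI hI' hV hg hW hQ' hχ fun r hr => hδ r (hcube hr)⟩⟩
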